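/- **Theorem 2.6.** For $P\in\mathbb{Z}[T]$ let $H(P)$ be the maximum modulus of its coefficients; for a real algebraic number $\alpha$ let $H(\alpha)=H(P)$, where $P$ is the (up to sign unique) minimal polynomial of $\alpha$ with coprime integer coefficients. For a transcendental real number $\zeta$ and an integer $n\ge 1$ define the following exponents in $[0,\infty]$: - $w_n(\zeta)$ is the supremum of the real $w$ such that $0<|P(\zeta)|\le H(P)^{-w}$ has infinitely many solutions $P\in\mathbb{Z}[T]$ of degree at most $n$; - $\lambda_n(\zeta)$ is the supremum of the real $\lambda$ such that $1\le |x|\le X$, $\max_{1\le i\le n}|\zeta^i x-y_i|\le X^{-\lambda}$ has a solution $(x,y_1,\dots,y_n)\in\mathbb{Z}^{n+1}$ for arbitrarily large $X$; - $\widehat{w}_n^{*}(\zeta)$ is the supremum of the real $w^*$ such that for all large $X$ there is a real algebraic number $\alpha$ of degree at most $n$ with $H(\alpha)\le X$ and $|\zeta-\alpha|\le H(\alpha)^{-1}X^{-w^*}$. Put $$\overline{w}(\zeta)=\limsup_{n\to\infty}\frac{w_n(\zeta)}{n},\quad \underline{w}(\zeta)=\liminf_{n\to\infty}\frac{w_n(\zeta)}{n},\quad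 \overline{\widehat{w}}^{*}(\zeta)=\limsup_{n\to\infty}\frac{\widehat{w}_n^{*}(\zeta)}{n},\quad \underline{\widehat{w}}^{*}(\zeta)=\liminf_{n\to\infty}\frac{\widehat{w}_n^{*}(\zeta)}{n},$$ $$\tau(\zeta)=\limsup_{n\to\infty}\frac{\log w_n(\zeta)}{\log n},\qquad \sigma(\zeta)=\limsup_{n\to\infty}\frac{\log\lambda_n(\zeta)}{\log n},\qquad \theta(\zeta)=\liminf_{n\to\infty}\frac{\log\widehat{w}_n^{*}(\zeta)}{\log n},$$ with the conventions $\log\infty=\infty$ and $1/\infty=0$. Then for every transcendental real number $\zeta$ $$\frac{1}{\overline{w}(\zeta)+2}\le \underline{\widehat{w}}^{*}(\zeta)\le\min\left\{\underline{w}(\zeta),\frac{4}{\overline{w}(\zeta)}\right\},\qquad \frac{1}{\underline{w}(\zeta)+2}\le \overline{\widehat{w}}^{*}(\zeta)\le\min\left\{\overline{w}(\zeta),\frac{4}{\underline{w}(\zeta)}\right\},$$ and $\theta(\zeta)=1/\tau(\zeta)$. If moreover $\zeta$ is not a Liouville number, then also $1/\tau(\zeta)=-\sigma(\zeta)$. 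-/

import Mathlib

open Filter Polynomial

noncomputable section

/-- The naive height `H(P)` of an integer polynomial: the maximum modulus of its coefficients. -/
def polyHeight (P : ℤ[X]) : ℕ := P.support.sup fun i => (P.coeff i).natAbs

/-- `P` is (up to sign) the minimal polynomial of the real algebraic number `α` with coprime
integer coefficients. Irreducibility in `ℤ[X]` of a polynomial with a root in `ℝ` means that it is
non-constant, primitive, and irreducible over `ℚ`. So `H(α) = polyHeight P`, and the degree of `α`
is `P.natDegree`. A real number `α` is algebraic if and only if such a `P` exists. -/
def IsIntMinpoly (α : ℝ) (P : ℤ[X]) : Prop := Irreducible P ∧ aeval α P = 0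

/-- The exponent `w_n(ζ)`: the supremum in `[-∞, ∞]` of the real `w` such that
`0 < |P(ζ)| ≤ H(P)^{-w}` has infinitely many solutions `P ∈ ℤ[T]` of degree at most `n`. -/
def wExp (n : ℕ) (ζ : ℝ) : EReal :=
  sSup ((fun w : ℝ => (w : EReal)) '' {w : ℝ |
    {P : ℤ[X] | P.natDegree ≤ n ∧ 0 < |aeval ζ P| ∧
      |aeval ζ P| ≤ (polyHeight P : ℝ) ^ (-w)}.Infinite})

/-- The exponent `λ_n(ζ)`: the supremum in `[-∞, ∞]` of the real `l` such that
`1 ≤ |x| ≤ X`, `max_{1 ≤ i ≤ n} |ζ^i x - y_i| ≤ X^{-l}` has an integer solution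
`(x, y_1, …, y_n)` for arbitrarily large `X`. -/
def lamExp (n : ℕ) (ζ : ℝ) : EReal :=
  sSup ((fun l : ℝ => (l : EReal)) '' {l : ℝ |
    ∃ᶠ X : ℝ in atTop, ∃ (x : ℤ) (y : ℕ → ℤ), 1 ≤ |(x : ℝ)| ∧ |(x : ℝ)| ≤ X ∧
      ∀ i ∈ Finset.Icc 1 n, |ζ ^ i * (x : ℝ) - (y i : ℝ)| ≤ X ^ (-l)})

/-- The exponent `ŵ*_n(ζ)`: the supremum in `[-∞, ∞]` of the real `w` such that for all large `X`
there is a real algebraic number `α` of degree at most `n` with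
`H(α) ≤ X` and `|ζ - α| ≤ H(α)^{-1} X^{-w}`. -/
def wHatStarExp (n : ℕ) (ζ : ℝ) : EReal :=
  sSup ((fun w : ℝ => (w : EReal)) '' {w : ℝ |
    ∀ᶠ X : ℝ in atTop, ∃ (α : ℝ) (P : ℤ[X]), IsIntMinpoly α P ∧ P.natDegree ≤ n ∧
      (polyHeight P : ℝ) ≤ X ∧ |ζ - α| ≤ (polyHeight P : ℝ)⁻¹ * X ^ (-w)})

/-- The logarithm `[0, ∞] → [-∞, ∞]` with `log 0 = -∞` and `log ∞ = ∞`, as a function on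
`[-∞, ∞]` (negative arguments are treated like `0`). -/
def extLog (x : EReal) : EReal := ENNReal.log x.toENNReal

/-- `limsup w_n(ζ) / n`. -/
def wSup (ζ : ℝ) : EReal := limsup (fun n : ℕ => wExp n ζ / (n : EReal)) atTop

/-- `liminf w_n(ζ) / n`. -/
def wInf (ζ : ℝ) : EReal := liminf (fun n : ℕ => wExp n ζ / (n : EReal)) atTop

/-- `limsup ŵ*_n(ζ) / n`. -/
def wHatStarSup (ζ : ℝ) : EReal := limsup (fun n : ℕ => wHatStarExp n ζ / (n : EReal)) atTop

/-- `liminf ŵ*_n(ζ) / n`. -/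
def wHatStarInf (ζ : ℝ) : EReal := liminf (fun n : ℕ => wHatStarExp n ζ / (n : EReal)) atTop

/-- `τ(ζ) = limsup log w_n(ζ) / log n`. -/
def tauOrder (ζ : ℝ) : EReal :=
  limsup (fun n : ℕ => extLog (wExp n ζ) / (Real.log n : EReal)) atTop

/-- `σ(ζ) = limsup log λ_n(ζ) / log n`. -/
def sigmaOrder (ζ : ℝ) : EReal :=
  limsup (fun n : ℕ => extLog (lamExp n ζ) / (Real.log n : EReal)) atTop

/-- `θ(ζ) = liminf log ŵ*_n(ζ) / log n`. -/
def thetaOrder (ζ : ℝ) : EReal :=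
  liminf (fun n : ℕ => extLog (wHatStarExp n ζ) / (Real.log n : EReal)) atTop

end

/-!
The theorem compares the exponents for different degrees. Two mechanisms carry it.

**No very small values of degree `n`.** Let `w > w_n(ζ)` and `m ≥ w + n`. By Dirichlet's theorem
there are, for every `X`, polynomials `P` of degree at most `n` and `Q` of degree at most `m` and of
heights at most `X`, with `|P(ζ)| ≪ X⁻ⁿ` and `|Q(ζ)| ≪ X⁻ᵐ`. Common factors of `P` and `Q` have degree
at most `n`, so that their values are not small; removing them from `Q` leaves a polynomial coprime
to `P` whose value is still `≪ X^(w - m) ≤ X⁻ⁿ` (`exists_coprime_pair`). Such a coprime pair is used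
in two ways.

* By Bézout, real multiples of `P` and `Q` combine to a large multiple of `T - ζ`. Rounding the
  cofactors to integer polynomials gives `R` of degree at most `n + m`, of height `≪ X`, with
  `|R(ζ)| ≪ X⁻ⁿ` and `R'(ζ) ≫ X`, hence a root within `≪ X^(-n-1)` of `ζ`. So `ŵ*_{n+m}(ζ) ≥ n`
  (`natCast_le_wHatStarExp`).
* Good simultaneous approximations `y_i` to `ζ^i x`, `i ≤ n + m`, define a functional `T^i ↦ y_i` on
  polynomials. It is integral and small, hence zero, at the multiples of `P` and of `Q`, so at `1` by
  Bézout, which contradicts `x ≠ 0`. So `λ_{n+m}(ζ) ≤ 1 / n` (`lamExp_le`).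

**A very small value of degree `n`.** Let `w < w_n(ζ)`, and let `P` of degree at most `n` and large
height satisfy `|P(ζ)| ≤ H(P)^(-w)`.

* If `N < w`, the resultant of `P` with the minimal polynomial of an algebraic number of degree at
  most `N` shows that such numbers cannot approximate `ζ` well, for a suitable `X`:
  `ŵ*_N(ζ) ≤ n (w + 1) / (w - N)` (`wHatStarExp_le`).
* If `w = 2N`, the pigeonhole principle yields an integer point `(x, y_1, …, y_N)` whose functional
  vanishes at all multiples of `P` and which approximates well at at most `n` indices. These can be
  chosen such that they control all the errors, because every `T^i - ζ^i` is, modulo `P`, a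
  combination of `n` of them with coefficients in `[-1, 1]` (`exists_bounded_reduction`). So
  `λ_N(ζ) ≥ 1 / (3n)` (`one_div_le_lamExp`).

Taking `N ≈ w_n(ζ) + 2n` in the first mechanism and `N ≈ w_n(ζ) / 2` in the second, together with the
elementary `n ≤ w_n(ζ)`, `1 ≤ ŵ*_n(ζ) ≤ w_n(ζ)`, and the boundedness of `λ_n(ζ)` for `ζ` not a Liouville
number, gives all the comparisons of upper and lower limits and of orders of growth. The Liouville
hypothesis is needed only when `τ(ζ) = ∞`, to exclude `σ(ζ) > 0`.
-/

/-! ### Heights of integer polynomials -/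

theorem abs_coeff_le_polyHeight (P : ℤ[X]) (i : ℕ) : |(P.coeff i : ℝ)| ≤ polyHeight P := by
  by_cases h : i ∈ P.support
  · have h1 := Finset.le_sup (f := fun i => (P.coeff i).natAbs) h
    have h2 : |(P.coeff i : ℝ)| = ((P.coeff i).natAbs : ℝ) := by
      rw [Nat.cast_natAbs, Int.cast_abs]
    rw [h2]
    exact_mod_cast h1
  · simp [notMem_support_iff.1 h]

theorem polyHeight_le {P : ℤ[X]} {B : ℝ} (hB : 0 ≤ B) (h : ∀ i, |(P.coeff i : ℝ)| ≤ B) :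
    (polyHeight P : ℝ) ≤ B := by
  refine (Nat.le_floor_iff hB).1 (Finset.sup_le fun i _ => Nat.le_floor ?_)
  rw [Nat.cast_natAbs, Int.cast_abs]
  exact h i

theorem one_le_polyHeight {P : ℤ[X]} (hP : P ≠ 0) : (1 : ℝ) ≤ polyHeight P := by
  refine le_trans ?_ (abs_coeff_le_polyHeight P P.natDegree)
  have : (1 : ℤ) ≤ |P.coeff P.natDegree| := Int.one_le_abs (by simpa using hP)
  exact_mod_cast this

theorem finite_polyHeight_le (n : ℕ) (B : ℝ) :
    {P : ℤ[X] | P.natDegree ≤ n ∧ (polyHeight P : ℝ) ≤ B}.Finite := by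
  have hfin : (Set.univ.pi fun _ : Fin (n + 1) => Set.Icc (-⌈B⌉) ⌈B⌉).Finite :=
    Set.Finite.pi fun _ => Set.finite_Icc _ _
  refine Set.Finite.of_finite_image (f := fun P : ℤ[X] => fun i : Fin (n + 1) => P.coeff i)
    (hfin.subset ?_) ?_
  · rintro _ ⟨P, ⟨-, hB⟩, rfl⟩ i -
    have h := (abs_coeff_le_polyHeight P i).trans (hB.trans (Int.le_ceil B))
    rw [Set.mem_Icc, ← abs_le]
    exact_mod_cast h
  · intro P hP Q hQ h
    ext i
    by_cases hi : i ≤ n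
    · exact congrFun h ⟨i, by omega⟩
    · rw [coeff_eq_zero_of_natDegree_lt (by have := hP.1; omega),
        coeff_eq_zero_of_natDegree_lt (by have := hQ.1; omega)]

theorem aeval_eq_eval_map (t : ℝ) (P : ℤ[X]) :
    aeval t P = (P.map (Int.castRingHom ℝ)).eval t := by
  rw [aeval_def, eval_map]; rfl

theorem eval_eq_sum_range_of_le {p : ℝ[X]} {n : ℕ} (hp : p.natDegree ≤ n) (t : ℝ) :
    p.eval t = ∑ i ∈ Finset.range (n + 1), p.coeff i * t ^ i :=
  eval_eq_sum_range' (by omega) t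

theorem aeval_eq_sum_range_of_le {P : ℤ[X]} {n : ℕ} (hP : P.natDegree ≤ n) (t : ℝ) :
    aeval t P = ∑ i ∈ Finset.range (n + 1), (P.coeff i : ℝ) * t ^ i := by
  rw [aeval_eq_eval_map, eval_eq_sum_range_of_le (natDegree_map_le.trans hP)]
  simp

/-- The sum `1 + |t| + ⋯ + |t|ⁿ`, which bounds `|p(t)|` for polynomials `p` of degree at most `n`
with coefficients in `[-1, 1]`. -/
noncomputable def absPowSum (t : ℝ) (n : ℕ) : ℝ := ∑ i ∈ Finset.range (n + 1), |t| ^ i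

theorem one_le_absPowSum (t : ℝ) (n : ℕ) : 1 ≤ absPowSum t n := by
  rw [absPowSum, Finset.sum_range_succ']
  have : 0 ≤ ∑ k ∈ Finset.range n, |t| ^ (k + 1) := Finset.sum_nonneg fun _ _ => by positivity
  simpa using this

theorem abs_pow_le_absPowSum (t : ℝ) {n i : ℕ} (hi : i ≤ n) : |t| ^ i ≤ absPowSum t n :=
  Finset.single_le_sum (f := fun i => |t| ^ i) (fun _ _ => by positivity)
    (Finset.mem_range.2 (by omega))

theorem abs_eval_le {p : ℝ[X]} {n : ℕ} (hp : p.natDegree ≤ n) {B : ℝ} (hB : ∀ i, |p.coeff i| ≤ B)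
    (t : ℝ) : |p.eval t| ≤ absPowSum t n * B := by
  rw [eval_eq_sum_range_of_le hp, absPowSum, Finset.sum_mul]
  refine (Finset.abs_sum_le_sum_abs _ _).trans (Finset.sum_le_sum fun i _ => ?_)
  rw [abs_mul, abs_pow, mul_comm]
  gcongr
  exact hB i

/-- A polynomial with coefficients bounded by `B` is Lipschitz near `s`, with a constant
proportional to `B`. -/
theorem abs_eval_sub_eval_le {p : ℝ[X]} {n : ℕ} (hp : p.natDegree ≤ n) {B : ℝ}
    (hB : ∀ i, |p.coeff i| ≤ B) {s t : ℝ} (hst : |s - t| ≤ 1) :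
    |p.eval s - p.eval t| ≤ (n + 1) * (n * (|s| + 1) ^ n) * B * |s - t| := by
  have hB0 : 0 ≤ B := (abs_nonneg _).trans (hB 0)
  have ht : |t| ≤ |s| + 1 := by
    have := abs_sub_abs_le_abs_sub t s
    rw [abs_sub_comm] at this
    linarith
  rw [eval_eq_sum_range_of_le hp, eval_eq_sum_range_of_le hp, ← Finset.sum_sub_distrib]
  calc |∑ i ∈ Finset.range (n + 1), (p.coeff i * s ^ i - p.coeff i * t ^ i)|
      ≤ ∑ i ∈ Finset.range (n + 1), |p.coeff i * s ^ i - p.coeff i * t ^ i| :=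
        Finset.abs_sum_le_sum_abs _ _
    _ ≤ ∑ i ∈ Finset.range (n + 1), (n * (|s| + 1) ^ n) * B * |s - t| := by
        refine Finset.sum_le_sum fun i hi => ?_
        have hin : i ≤ n := by simpa [Nat.lt_succ_iff] using hi
        rw [← mul_sub, abs_mul]
        have h1 : |s ^ i - t ^ i| ≤ |s - t| * (n * (|s| + 1) ^ n) := by
          refine (abs_pow_sub_pow_le s t i).trans ?_
          rw [mul_assoc]
          gcongr
          calc max |s| |t| ^ (i - 1) ≤ (|s| + 1) ^ (i - 1) := by
                gcongr; exact max_le (by linarith) ht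
            _ ≤ (|s| + 1) ^ n := by
                apply pow_le_pow_right₀ _ (by omega)
                linarith [abs_nonneg s]
        calc |p.coeff i| * |s ^ i - t ^ i| ≤ B * (|s - t| * (n * (|s| + 1) ^ n)) := by
              gcongr; exact hB i
          _ = _ := by ring
    _ = _ := by
        rw [Finset.sum_const, Finset.card_range, nsmul_eq_mul]; push_cast; ring

theorem abs_aeval_sub_aeval_le {P : ℤ[X]} {n : ℕ} (hP : P.natDegree ≤ n) {s t : ℝ}
    (hst : |s - t| ≤ 1) :
    |aeval s P - aeval t P| ≤ (n + 1) * (n * (|s| + 1) ^ n) * polyHeight P * |s - t| := by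
  rw [aeval_eq_eval_map, aeval_eq_eval_map]
  exact abs_eval_sub_eval_le (natDegree_map_le.trans hP)
    (fun i => by simpa using abs_coeff_le_polyHeight P i) hst

/-! ### The Mahler measure as a multiplicative height -/

/-- The Mahler measure of an integer polynomial. -/
noncomputable def intMahler (P : ℤ[X]) : ℝ := (P.map (Int.castRingHom ℂ)).mahlerMeasure

theorem intMahler_mul (P Q : ℤ[X]) : intMahler (P * Q) = intMahler P * intMahler Q := by
  rw [intMahler, Polynomial.map_mul, mahlerMeasure_mul]; rfl

theorem intMahler_one : intMahler 1 = 1 := by simp [intMahler]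

theorem one_le_intMahler {P : ℤ[X]} (hP : P ≠ 0) : 1 ≤ intMahler P :=
  one_le_mahlerMeasure_of_ne_zero hP

theorem intMahler_le {P : ℤ[X]} {n : ℕ} (hP : P.natDegree ≤ n) :
    intMahler P ≤ (n + 1) * polyHeight P := by
  refine (mahlerMeasure_le_sum_norm_coeff _).trans ?_
  rw [sum_over_range' _ (by simp) (n + 1) (Nat.lt_succ_of_le (natDegree_map_le.trans hP))]
  calc _ ≤ ∑ i ∈ Finset.range (n + 1), (polyHeight P : ℝ) := by
        refine Finset.sum_le_sum fun i _ => ?_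
        have := abs_coeff_le_polyHeight P i
        simpa using this
    _ = _ := by simp

theorem polyHeight_le_intMahler {P : ℤ[X]} {n : ℕ} (hP : P.natDegree ≤ n) :
    (polyHeight P : ℝ) ≤ 2 ^ n * intMahler P := by
  have h0 : 0 ≤ intMahler P := mahlerMeasure_nonneg _
  refine polyHeight_le (by positivity) fun i => ?_
  have h := norm_coeff_le_choose_mul_mahlerMeasure i (P.map (Int.castRingHom ℂ))
  rw [coeff_map] at h
  have h1 : ‖(Int.castRingHom ℂ) (P.coeff i)‖ = |(P.coeff i : ℝ)| := by simp
  rw [h1] at h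
  refine h.trans (mul_le_mul_of_nonneg_right ?_ h0)
  calc (((P.map (Int.castRingHom ℂ)).natDegree.choose i : ℕ) : ℝ)
      ≤ ((2 ^ (P.map (Int.castRingHom ℂ)).natDegree : ℕ) : ℝ) := by
        exact_mod_cast Nat.choose_le_two_pow _ _
    _ ≤ 2 ^ n := by
        push_cast
        exact pow_le_pow_right₀ (by norm_num) (natDegree_map_le.trans hP)

theorem intMahler_le_of_dvd {D R : ℤ[X]} (hD : D ∣ R) (hR : R ≠ 0) :
    intMahler D ≤ intMahler R := by
  obtain ⟨E, rfl⟩ := hD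
  rw [intMahler_mul]
  exact le_mul_of_one_le_right (mahlerMeasure_nonneg _)
    (one_le_intMahler (right_ne_zero_of_mul hR))

/-- The height of a factor is bounded in terms of the height (Gelfond's inequality). -/
theorem polyHeight_le_of_dvd {D R : ℤ[X]} (hD : D ∣ R) (hR : R ≠ 0) {N : ℕ}
    (hN : R.natDegree ≤ N) : (polyHeight D : ℝ) ≤ 2 ^ N * ((N + 1) * polyHeight R) :=
  (polyHeight_le_intMahler ((natDegree_le_of_dvd hD hR).trans hN)).trans <| by
    gcongr
    exact (intMahler_le_of_dvd hD hR).trans (intMahler_le hN)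

/-! ### Common factors of integer polynomials -/

theorem isCoprime_map_of_irreducible {D P : ℤ[X]} (hD : Irreducible D) (h0 : D.natDegree ≠ 0)
    (h : ¬ D ∣ P) :
    IsCoprime (D.map (Int.castRingHom ℝ)) (P.map (Int.castRingHom ℝ)) := by
  have hprim : D.IsPrimitive := hD.isPrimitive h0
  have hQ : IsCoprime (D.map (Int.castRingHom ℚ)) (P.map (Int.castRingHom ℚ)) := by
    rw [((IsPrimitive.Int.irreducible_iff_irreducible_map_cast hprim).1 hD).coprime_iff_not_dvd]
    rwa [← IsPrimitive.Int.dvd_iff_map_cast_dvd_map_cast _ _ hprim]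
  have hcomp : (algebraMap ℚ ℝ).comp (Int.castRingHom ℚ) = Int.castRingHom ℝ := RingHom.ext_int _ _
  simpa [Polynomial.map_map, hcomp] using hQ.map (mapRingHom (algebraMap ℚ ℝ))

/-- Integer polynomials that are not coprime over `ℝ` have a non-constant common factor in `ℤ[X]`. -/
theorem exists_common_factor {P Q : ℤ[X]} (hP : P ≠ 0)
    (h : ¬ IsCoprime (P.map (Int.castRingHom ℝ)) (Q.map (Int.castRingHom ℝ))) :
    ∃ D : ℤ[X], 1 ≤ D.natDegree ∧ D ∣ P ∧ D ∣ Q := by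
  by_contra! hno
  apply h
  clear h
  induction P using WfDvdMonoid.induction_on_irreducible with
  | zero => exact absurd rfl hP
  | unit u hu =>
    exact isCoprime_one_left.of_isCoprime_of_dvd_left
      (isUnit_iff_dvd_one.1 (hu.map (mapRingHom (Int.castRingHom ℝ))))
  | mul a i ha hi ih =>
    rw [Polynomial.map_mul]
    refine IsCoprime.mul_left ?_ (ih ha fun D hD hDa => hno D hD (hDa.mul_left i))
    by_cases hi0 : i.natDegree = 0
    · obtain ⟨c, hc⟩ := natDegree_eq_zero.1 hi0
      have hc0 : c ≠ 0 := by
        rintro rfl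
        exact hi.ne_zero (by rw [← hc, C_0])
      rw [← hc, map_C]
      exact isCoprime_one_left.of_isCoprime_of_dvd_left
        (isUnit_iff_dvd_one.1 (isUnit_C.2 (isUnit_iff_ne_zero.2 (by simpa using hc0))))
    · exact isCoprime_map_of_irreducible hi hi0
        (hno i (Nat.one_le_iff_ne_zero.2 hi0) (dvd_mul_right i a))

theorem exists_isIntMinpoly {α : ℝ} {R : ℤ[X]} (hR : R ≠ 0) (h : aeval α R = 0) :
    ∃ P, IsIntMinpoly α P ∧ P ∣ R := by
  induction R using WfDvdMonoid.induction_on_irreducible with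
  | zero => exact absurd rfl hR
  | unit u hu =>
    exact absurd h (hu.map (aeval α)).ne_zero
  | mul a i ha hi ih =>
    rw [map_mul, mul_eq_zero] at h
    rcases h with h | h
    · exact ⟨i, ⟨hi, h⟩, dvd_mul_right i a⟩
    · obtain ⟨P, h1, h2⟩ := ih ha h
      exact ⟨P, h1, h2.mul_left i⟩

theorem IsIntMinpoly.natDegree_ne_zero {α : ℝ} {P : ℤ[X]} (h : IsIntMinpoly α P) :
    P.natDegree ≠ 0 := by
  intro h0
  obtain ⟨c, hc⟩ := natDegree_eq_zero.1 h0
  have h2 := h.2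
  rw [← hc, aeval_C] at h2
  have : c = 0 := by simpa using h2
  exact h.1.ne_zero (by rw [← hc, this, C_0])

/-! ### The exponent `w_n` and small values of integer polynomials -/

theorem coeff_sum_range_monomial {R : Type*} [Semiring R] (a : ℕ → R) (n i : ℕ) :
    (∑ k ∈ Finset.range (n + 1), monomial k (a k)).coeff i = if i ≤ n then a i else 0 := by
  simp [finsetSum_coeff, coeff_monomial]

theorem natDegree_sum_range_monomial_le {R : Type*} [Semiring R] (a : ℕ → R) (n : ℕ) :
    (∑ k ∈ Finset.range (n + 1), monomial k (a k)).natDegree ≤ n :=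
  natDegree_le_iff_coeff_eq_zero.2 fun i hi => by
    rw [coeff_sum_range_monomial, if_neg (by omega)]

theorem aeval_ne_zero_of_transcendental {ζ : ℝ} (hζ : Transcendental ℚ ζ) {P : ℤ[X]} (hP : P ≠ 0) :
    aeval ζ P ≠ 0 := by
  intro h
  refine hζ ⟨P.map (Int.castRingHom ℚ), ?_, ?_⟩
  · rwa [Ne, Polynomial.map_eq_zero_iff (RingHom.injective_int _)]
  · rw [← h, aeval_def, eval₂_map, aeval_def]
    congr 1

/-- Dirichlet's theorem on small values of integer polynomials, by the pigeonhole principle. -/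
theorem exists_polynomial_small_value (ζ : ℝ) (n : ℕ) {X : ℝ} (hX : 1 ≤ X) :
    ∃ P : ℤ[X], P ≠ 0 ∧ P.natDegree ≤ n ∧ (polyHeight P : ℝ) ≤ X ∧
      |aeval ζ P| ≤ 4 * absPowSum ζ n * X ^ (-(n : ℝ)) := by
  set A := absPowSum ζ n with hA
  have hA1 : 1 ≤ A := one_le_absPowSum ζ n
  have hX0 : 0 < X := by linarith
  set M := ⌊X⌋₊ with hM
  set δ := 4 * A * X ^ (-(n : ℝ)) with hδ
  have hδ0 : 0 < δ := by positivity
  have hMX : (M : ℝ) ≤ X := Nat.floor_le hX0.le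
  have hXM : X < M + 1 := Nat.lt_floor_add_one X
  have hM1 : 1 ≤ M := Nat.le_floor (by simpa using hX)
  set val : (Fin (n + 1) → Fin (M + 1)) → ℝ := fun c => ∑ i, ((c i : ℕ) : ℝ) * ζ ^ (i : ℕ) with hval
  have hvalA : ∀ c, |val c| ≤ A * X := by
    intro c
    rw [hA, absPowSum, Finset.sum_range, Finset.sum_mul]
    refine (Finset.abs_sum_le_sum_abs _ _).trans (Finset.sum_le_sum fun i _ => ?_)
    rw [abs_mul, abs_pow, mul_comm]
    gcongr
    rw [Nat.abs_cast]
    refine le_trans ?_ hMX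
    exact_mod_cast Nat.lt_succ_iff.1 (c i).2
  set g : (Fin (n + 1) → Fin (M + 1)) → ℕ := fun c => ⌊(val c + A * X) / δ⌋₊ with hg
  set K := ⌊2 * A * X / δ⌋₊ with hK
  have hcard : (Finset.range (K + 1)).card < (Finset.univ : Finset (Fin (n + 1) → Fin (M + 1))).card := by
    rw [Finset.card_range, Finset.card_univ, Fintype.card_fun, Fintype.card_fin, Fintype.card_fin]
    have h1 : (K : ℝ) ≤ X ^ (n + 1) / 2 := by
      refine (Nat.floor_le (by positivity)).trans (le_of_eq ?_)
      rw [hδ, Real.rpow_neg hX0.le, Real.rpow_natCast]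
      field_simp
      ring
    have h2 : X ^ (n + 1) < ((M : ℝ) + 1) ^ (n + 1) := by gcongr
    have h3 : (2 : ℝ) ≤ ((M : ℝ) + 1) ^ (n + 1) := by
      have : (1 : ℝ) ≤ M := by exact_mod_cast hM1
      calc (2 : ℝ) ≤ (M : ℝ) + 1 := by linarith
        _ ≤ ((M : ℝ) + 1) ^ (n + 1) := le_self_pow₀ (by linarith) (by omega)
    have : (K : ℝ) + 1 < ((M : ℝ) + 1) ^ (n + 1) := by linarith
    exact_mod_cast this
  obtain ⟨c, -, c', -, hne, heq⟩ := Finset.exists_ne_map_eq_of_card_lt_of_maps_to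
    (f := g) hcard (fun c _ => by
      simp only [Finset.coe_range, Set.mem_Iio, Nat.lt_succ_iff, hg, hK]
      refine Nat.floor_le_floor ?_
      gcongr
      linarith [(abs_le.1 (hvalA c)).2])
  set a : ℕ → ℤ := fun i => if h : i < n + 1 then ((c ⟨i, h⟩ : ℕ) : ℤ) - ((c' ⟨i, h⟩ : ℕ) : ℤ) else 0
    with ha
  set P : ℤ[X] := ∑ k ∈ Finset.range (n + 1), monomial k (a k) with hP
  have hPdeg : P.natDegree ≤ n := natDegree_sum_range_monomial_le a n
  have hcoeff : ∀ i, P.coeff i = a i := by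
    intro i
    rw [hP, coeff_sum_range_monomial]
    split_ifs with h
    · rfl
    · simp only [ha]; rw [dif_neg (by omega)]
  refine ⟨P, ?_, hPdeg, ?_, ?_⟩
  · intro h0
    apply hne
    funext i
    have := hcoeff i
    rw [h0, coeff_zero] at this
    simp only [ha, i.2, dif_pos] at this
    ext
    have h' : ((c i : ℕ) : ℤ) = ((c' i : ℕ) : ℤ) := by linarith
    exact_mod_cast h'
  · refine polyHeight_le hX0.le fun i => le_trans ?_ hMX
    rw [hcoeff]
    simp only [ha]
    split_ifs with h
    · have h1 := (c ⟨i, h⟩).2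
      have h2 := (c' ⟨i, h⟩).2
      have : |((c ⟨i, h⟩ : ℕ) : ℤ) - ((c' ⟨i, h⟩ : ℕ) : ℤ)| ≤ M := by
        rw [abs_le]; constructor <;> omega
      exact_mod_cast this
    · simp
  · have hval2 : aeval ζ P = val c - val c' := by
      rw [aeval_eq_sum_range_of_le hPdeg, Finset.sum_range, hval, ← Finset.sum_sub_distrib]
      refine Finset.sum_congr rfl fun i _ => ?_
      rw [hcoeff]
      simp only [ha, i.2, dif_pos]
      push_cast
      ring
    have hnn : ∀ c, 0 ≤ (val c + A * X) / δ := fun c => by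
      have := (abs_le.1 (hvalA c)).1
      exact div_nonneg (by linarith) hδ0.le
    have h1 := Nat.floor_le (hnn c)
    have h2 := Nat.lt_floor_add_one ((val c + A * X) / δ)
    have h3 := Nat.floor_le (hnn c')
    have h4 := Nat.lt_floor_add_one ((val c' + A * X) / δ)
    have heq' : (⌊(val c + A * X) / δ⌋₊ : ℝ) = ⌊(val c' + A * X) / δ⌋₊ := by exact_mod_cast heq
    have h5 : |(val c + A * X) / δ - (val c' + A * X) / δ| ≤ 1 := by
      rw [abs_le]; constructor <;> linarith
    rw [hval2]
    have h6 : (val c + A * X) / δ - (val c' + A * X) / δ = (val c - val c') / δ := by ring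
    rwa [h6, abs_div, abs_of_pos hδ0, div_le_one hδ0] at h5

/-- Real numbers above `w_n(ζ)` are exponents of a lower bound for the values at `ζ` of all nonzero
integer polynomials of degree at most `n`. -/
theorem exists_lower_bound_of_wExp_lt {ζ : ℝ} (hζ : Transcendental ℚ ζ) {n : ℕ} {w : ℝ}
    (hw0 : 0 ≤ w) (hw : wExp n ζ < w) :
    ∃ c : ℝ, 0 < c ∧ c ≤ 1 ∧ ∀ P : ℤ[X], P ≠ 0 → P.natDegree ≤ n →
      c * (polyHeight P : ℝ) ^ (-w) ≤ |aeval ζ P| := by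
  set S := {P : ℤ[X] | P.natDegree ≤ n ∧ 0 < |aeval ζ P| ∧
      |aeval ζ P| ≤ (polyHeight P : ℝ) ^ (-w)} with hS
  have hfin : S.Finite := by
    by_contra hinf
    exact not_lt.2 (le_sSup (Set.mem_image_of_mem _ (show w ∈ _ from hinf))) hw
  set s := ∑ P ∈ hfin.toFinset, |aeval ζ P|⁻¹ with hs
  have hs0 : 0 ≤ s := Finset.sum_nonneg fun _ _ => by positivity
  refine ⟨(1 + s)⁻¹, by positivity, inv_le_one_of_one_le₀ (by linarith), fun P hP hdeg => ?_⟩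
  have hpos : 0 < |aeval ζ P| := abs_pos.2 (aeval_ne_zero_of_transcendental hζ hP)
  have hH := one_le_polyHeight hP
  have hH1 : (polyHeight P : ℝ) ^ (-w) ≤ 1 := Real.rpow_le_one_of_one_le_of_nonpos hH (by linarith)
  have hc1 : (1 + s)⁻¹ ≤ 1 := inv_le_one_of_one_le₀ (by linarith)
  by_cases hPS : P ∈ S
  · have h1 : |aeval ζ P|⁻¹ ≤ s :=
      Finset.single_le_sum (f := fun P : ℤ[X] => |aeval ζ P|⁻¹) (fun _ _ => by positivity)
        (hfin.mem_toFinset.2 hPS)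
    calc (1 + s)⁻¹ * (polyHeight P : ℝ) ^ (-w) ≤ (1 + s)⁻¹ * 1 := by gcongr
      _ = (1 + s)⁻¹ := mul_one _
      _ ≤ |aeval ζ P| := inv_le_of_inv_le₀ hpos (by linarith)
  · have h1 : (polyHeight P : ℝ) ^ (-w) < |aeval ζ P| := by
      by_contra! h
      exact hPS ⟨hdeg, hpos, h⟩
    calc (1 + s)⁻¹ * (polyHeight P : ℝ) ^ (-w) ≤ 1 * (polyHeight P : ℝ) ^ (-w) := by gcongr
      _ ≤ _ := by linarith

/-- The infinitely many solutions in the definition of `w_n(ζ)` have unbounded heights. -/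
theorem exists_of_lt_wExp {ζ : ℝ} {n : ℕ} {w : ℝ} (hw : (w : EReal) < wExp n ζ) (B : ℝ) :
    ∃ P : ℤ[X], P.natDegree ≤ n ∧ B < polyHeight P ∧ P ≠ 0 ∧
      |aeval ζ P| ≤ (polyHeight P : ℝ) ^ (-w) := by
  obtain ⟨_, ⟨v, hv, rfl⟩, hwv⟩ := lt_sSup_iff.1 hw
  have hwv' : w < v := EReal.coe_lt_coe_iff.1 hwv
  obtain ⟨P, ⟨hdeg, hpos, hle⟩, hnot⟩ :=
    Set.Infinite.exists_notMem_finite hv (finite_polyHeight_le n B)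
  have hP : P ≠ 0 := by
    rintro rfl
    simp at hpos
  refine ⟨P, hdeg, ?_, hP, hle.trans ?_⟩
  · by_contra! h
    exact hnot ⟨hdeg, h⟩
  · exact Real.rpow_le_rpow_of_exponent_le (one_le_polyHeight hP) (by linarith)

/-- Arbitrarily small nonzero values come from infinitely many polynomials. -/
theorem le_wExp_of_forall_exists {ζ : ℝ} {n : ℕ} {w : ℝ}
    (h : ∀ ε > 0, ∃ P : ℤ[X], P.natDegree ≤ n ∧ 0 < |aeval ζ P| ∧ |aeval ζ P| < ε ∧
      |aeval ζ P| ≤ (polyHeight P : ℝ) ^ (-w)) : (w : EReal) ≤ wExp n ζ := by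
  refine le_sSup (Set.mem_image_of_mem _ ?_)
  intro hfin
  set S := {P : ℤ[X] | P.natDegree ≤ n ∧ 0 < |aeval ζ P| ∧
      |aeval ζ P| ≤ (polyHeight P : ℝ) ^ (-w)} with hS
  set s := ∑ P ∈ hfin.toFinset, |aeval ζ P|⁻¹ with hs
  have hs0 : 0 ≤ s := Finset.sum_nonneg fun _ _ => by positivity
  obtain ⟨P, hdeg, hpos, hlt, hle⟩ := h (1 + s)⁻¹ (by positivity)
  have h1 : |aeval ζ P|⁻¹ ≤ s :=
    Finset.single_le_sum (f := fun P : ℤ[X] => |aeval ζ P|⁻¹) (fun _ _ => by positivity)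
      (hfin.mem_toFinset.2 ⟨hdeg, hpos, hle⟩)
  have h2 : 1 + s < |aeval ζ P|⁻¹ := (lt_inv_comm₀ hpos (by positivity)).1 hlt
  linarith

/-- Constants are absorbed by a loss in the exponent. -/
theorem eventually_mul_rpow_le {a b : ℝ} (hab : a < b) (C : ℝ) :
    ∀ᶠ X : ℝ in atTop, C * X ^ a ≤ X ^ b := by
  filter_upwards [(tendsto_rpow_atTop (sub_pos.2 hab)).eventually_ge_atTop C, eventually_gt_atTop 0]
    with X h1 h2
  calc C * X ^ a ≤ X ^ (b - a) * X ^ a := by gcongr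
    _ = X ^ b := by rw [← Real.rpow_add h2]; ring_nf

theorem natCast_le_wExp {ζ : ℝ} (hζ : Transcendental ℚ ζ) {n : ℕ} (hn : 1 ≤ n) :
    (n : EReal) ≤ wExp n ζ := by
  have key : ∀ v : ℝ, 0 ≤ v → v < n → (v : EReal) ≤ wExp n ζ := by
    intro v hv0 hvn
    refine le_wExp_of_forall_exists fun ε hε => ?_
    have hn0 : (0 : ℝ) < n := by exact_mod_cast hn
    have hlim : Tendsto (fun X : ℝ => 4 * absPowSum ζ n * X ^ (-(n : ℝ))) atTop (nhds 0) := by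
      simpa using (tendsto_rpow_neg_atTop hn0).const_mul (4 * absPowSum ζ n)
    obtain ⟨X, ⟨h1, h2⟩, h3⟩ := ((hlim.eventually_lt_const hε).and
      (eventually_mul_rpow_le (neg_lt_neg hvn) (4 * absPowSum ζ n))).and
      (eventually_ge_atTop 1) |>.exists
    obtain ⟨P, hP, hdeg, hH, hval⟩ := exists_polynomial_small_value ζ n h3
    have hH1 := one_le_polyHeight hP
    exact ⟨P, hdeg, abs_pos.2 (aeval_ne_zero_of_transcendental hζ hP), hval.trans_lt h1,
      hval.trans (h2.trans (Real.rpow_le_rpow_of_nonpos (by linarith) hH (by linarith)))⟩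
  refine le_of_forall_lt fun x hx => ?_
  obtain ⟨w, hxw, hwn⟩ := EReal.lt_iff_exists_real_btwn.1 hx
  have hwn' : w < n := by exact_mod_cast hwn
  refine hxw.trans_le (le_trans ?_ (key (max w 0) (le_max_right _ _)
    (max_lt hwn' (by exact_mod_cast hn))))
  exact_mod_cast le_max_left w 0

/-! ### Coprime pairs of polynomials with small values -/

/-- If the values at `ζ` of polynomials of degree at most `n` are bounded below, then every `Q` is
the product of a polynomial coprime to `P` and of a polynomial `E` for which the same lower bound
holds: `E` is a product of factors of polynomials of degree at most `n`, and the Mahler measure is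
multiplicative. -/
theorem exists_coprime_part {ζ : ℝ} {n : ℕ} {w c : ℝ} (hc0 : 0 < c) (hc1 : c ≤ 1)
    (hc : ∀ D : ℤ[X], D ≠ 0 → D.natDegree ≤ n → c * intMahler D ^ (-w) ≤ |aeval ζ D|)
    {P : ℤ[X]} (hP : P ≠ 0) (hPn : P.natDegree ≤ n) (Q : ℤ[X]) (hQ : Q ≠ 0) :
    ∃ Q' E : ℤ[X], Q = Q' * E ∧
      IsCoprime (P.map (Int.castRingHom ℝ)) (Q'.map (Int.castRingHom ℝ)) ∧
      c ^ E.natDegree * intMahler E ^ (-w) ≤ |aeval ζ E| := by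
  induction hd : Q.natDegree using Nat.strong_induction_on generalizing Q with
  | _ d ih =>
    by_cases hcop : IsCoprime (P.map (Int.castRingHom ℝ)) (Q.map (Int.castRingHom ℝ))
    · exact ⟨Q, 1, by simp, hcop, by simp [intMahler_one]⟩
    · obtain ⟨D, hD1, hDP, Q₁, rfl⟩ := exists_common_factor hP hcop
      have hD := left_ne_zero_of_mul hQ
      have hQ₁ := right_ne_zero_of_mul hQ
      rw [natDegree_mul hD hQ₁] at hd
      obtain ⟨Q', E, rfl, hcop', hE⟩ := ih Q₁.natDegree (by omega) Q₁ hQ₁ rfl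
      have hE0 := right_ne_zero_of_mul hQ₁
      refine ⟨Q', D * E, by ring, hcop', ?_⟩
      have hDn := (natDegree_le_of_dvd hDP hP).trans hPn
      have hMD := one_le_intMahler hD
      have hME := one_le_intMahler hE0
      rw [natDegree_mul hD hE0, intMahler_mul, map_mul, abs_mul, pow_add,
        Real.mul_rpow (by linarith) (by linarith)]
      calc c ^ D.natDegree * c ^ E.natDegree * (intMahler D ^ (-w) * intMahler E ^ (-w))
          = (c ^ D.natDegree * intMahler D ^ (-w)) * (c ^ E.natDegree * intMahler E ^ (-w)) := by
            ring
        _ ≤ |aeval ζ D| * |aeval ζ E| := by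
            have : c ^ D.natDegree ≤ c := pow_le_of_le_one hc0.le hc1 (by omega)
            have h2 : c ^ D.natDegree * intMahler D ^ (-w) ≤ c * intMahler D ^ (-w) := by gcongr
            gcongr
            exact h2.trans (hc D hD hDn)

/-- If `m ≥ w + n` for some `w > w_n(ζ)`, then for every `X ≥ 1` there is a coprime pair of
integer polynomials of degrees at most `n` and `m` and of heights `≪ X` whose values at `ζ` are
`≪ X⁻ⁿ`. -/
theorem exists_coprime_pair {ζ : ℝ} (hζ : Transcendental ℚ ζ) {n m : ℕ} {w : ℝ} (hw0 : 0 ≤ w)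
    (hw : wExp n ζ < w) (hm : w + n ≤ m) :
    ∃ K : ℝ, 1 ≤ K ∧ ∀ X : ℝ, 1 ≤ X → ∃ P Q : ℤ[X], P ≠ 0 ∧ Q ≠ 0 ∧
      IsCoprime (P.map (Int.castRingHom ℝ)) (Q.map (Int.castRingHom ℝ)) ∧
      P.natDegree ≤ n ∧ Q.natDegree ≤ m ∧ (polyHeight P : ℝ) ≤ K * X ∧
      (polyHeight Q : ℝ) ≤ K * X ∧ |aeval ζ P| ≤ K * X ^ (-(n : ℝ)) ∧
      |aeval ζ Q| ≤ K * X ^ (-(n : ℝ)) := by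
  obtain ⟨c, hc0, hc1, hc⟩ := exists_lower_bound_of_wExp_lt hζ hw0 hw
  set c₁ := c * ((2 : ℝ) ^ n) ^ (-w) with hc₁
  have hc₁0 : 0 < c₁ := by positivity
  have hc₁1 : c₁ ≤ 1 := by
    refine mul_le_one₀ hc1 (by positivity) ?_
    exact Real.rpow_le_one_of_one_le_of_nonpos (one_le_pow₀ (by norm_num)) (by linarith)
  have hM : ∀ D : ℤ[X], D ≠ 0 → D.natDegree ≤ n → c₁ * intMahler D ^ (-w) ≤ |aeval ζ D| := by
    intro D hD hDn
    refine le_trans ?_ (hc D hD hDn)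
    have h1 := one_le_polyHeight hD
    have h2 := one_le_intMahler hD
    rw [hc₁, mul_assoc, ← Real.mul_rpow (by positivity) (by linarith)]
    gcongr 1
    exact Real.rpow_le_rpow_of_nonpos (by linarith) (polyHeight_le_intMahler hDn) (by linarith)
  set K₁ := 4 * absPowSum ζ m * (c₁⁻¹ ^ m * (m + 1 : ℝ) ^ w) with hK₁
  set K₂ := (2 : ℝ) ^ m * (m + 1 : ℝ) with hK₂
  have hA := one_le_absPowSum ζ n
  have hA' := one_le_absPowSum ζ m
  have hK₁0 : 0 ≤ K₁ := by positivity
  have hK₂0 : 0 ≤ K₂ := by positivity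
  refine ⟨1 + 4 * absPowSum ζ n + K₁ + K₂, by linarith, fun X hX => ?_⟩
  have hX0 : 0 < X := by linarith
  obtain ⟨P, hP, hPn, hPH, hPv⟩ := exists_polynomial_small_value ζ n hX
  obtain ⟨Q, hQ, hQm, hQH, hQv⟩ := exists_polynomial_small_value ζ m hX
  obtain ⟨Q', E, hQE, hcop, hE⟩ := exists_coprime_part hc₁0 hc₁1 hM hP hPn Q hQ
  have hQ'0 : Q' ≠ 0 := left_ne_zero_of_mul (hQE ▸ hQ)
  have hE0 : E ≠ 0 := right_ne_zero_of_mul (hQE ▸ hQ)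
  have hdvd : Q' ∣ Q := ⟨E, hQE⟩
  refine ⟨P, Q', hP, hQ'0, hcop, hPn, (natDegree_le_of_dvd hdvd hQ).trans hQm, ?_, ?_, ?_, ?_⟩
  · exact hPH.trans (le_mul_of_one_le_left hX0.le (by linarith))
  · refine (polyHeight_le_of_dvd hdvd hQ hQm).trans ?_
    calc (2 : ℝ) ^ m * ((m + 1) * polyHeight Q) ≤ 2 ^ m * ((m + 1) * X) := by gcongr
      _ = K₂ * X := by rw [hK₂]; ring
      _ ≤ _ := by gcongr; linarith
  · refine hPv.trans ?_
    gcongr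
    linarith
  · have hME1 := one_le_intMahler hE0
    have hME : intMahler E ≤ (m + 1) * X := by
      refine (intMahler_le_of_dvd ⟨Q', by rw [hQE, mul_comm]⟩ hQ).trans ((intMahler_le hQm).trans ?_)
      gcongr
    have hEm : E.natDegree ≤ m :=
      (natDegree_le_of_dvd ⟨Q', by rw [hQE, mul_comm]⟩ hQ).trans hQm
    have hEv : c₁ ^ m * ((m + 1) * X) ^ (-w) ≤ |aeval ζ E| := by
      refine le_trans ?_ hE
      have h1 : c₁ ^ m ≤ c₁ ^ E.natDegree := pow_le_pow_of_le_one hc₁0.le hc₁1 hEm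
      have h2 : ((m + 1) * X) ^ (-w) ≤ intMahler E ^ (-w) :=
        Real.rpow_le_rpow_of_nonpos (by linarith) hME (by linarith)
      gcongr
    have hprod : |aeval ζ Q'| * |aeval ζ E| ≤ 4 * absPowSum ζ m * X ^ (-(m : ℝ)) := by
      rw [← abs_mul, ← map_mul, ← hQE]
      exact hQv
    have hlow : 0 < c₁ ^ m * ((m + 1) * X) ^ (-w) := by positivity
    have h1 : |aeval ζ Q'| ≤ 4 * absPowSum ζ m * X ^ (-(m : ℝ)) /
        (c₁ ^ m * ((m + 1) * X) ^ (-w)) := by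
      rw [le_div_iff₀ hlow]
      exact (mul_le_mul_of_nonneg_left hEv (abs_nonneg _)).trans hprod
    calc |aeval ζ Q'| ≤ _ := h1
      _ = K₁ * (X ^ (-(m : ℝ)) * X ^ w) := by
        rw [hK₁, Real.rpow_neg (by positivity) w, Real.mul_rpow (by positivity) hX0.le, inv_pow]
        field_simp
      _ = K₁ * X ^ (-(m : ℝ) + w) := by rw [Real.rpow_add hX0]
      _ ≤ K₁ * X ^ (-(n : ℝ)) := by
        gcongr 1
        exact Real.rpow_le_rpow_of_exponent_le hX (by linarith)
      _ ≤ _ := by gcongr; linarith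

/-! ### Lower bound for `ŵ*_n` -/

/-- Bézout's identity for real polynomials, with control of the degrees. -/
theorem exists_mul_add_mul_eq {p q : ℝ[X]} (hp : p ≠ 0) (h : IsCoprime p q) {N : ℕ}
    (hN : p.natDegree + q.natDegree ≤ N) {F : ℝ[X]} (hF : F.natDegree ≤ N) :
    ∃ a b : ℝ[X], a * p + b * q = F ∧ a.natDegree + p.natDegree ≤ N ∧
      b.natDegree + q.natDegree ≤ N := by
  obtain ⟨u, v, huv⟩ := h
  set b := F * v % p with hb
  set a := F * u + q * (F * v / p) with ha
  have hab : a * p + b * q = F := by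
    have h1 : p * (F * v / p) + F * v % p = F * v := EuclideanDomain.div_add_mod _ _
    calc a * p + b * q = F * (u * p) + q * (p * (F * v / p) + F * v % p) := by rw [ha, hb]; ring
      _ = F * (u * p + v * q) := by rw [h1]; ring
      _ = F := by rw [huv, mul_one]
  have hbdeg : b.natDegree ≤ p.natDegree :=
    natDegree_le_natDegree (EuclideanDomain.mod_lt (F * v) hp).le
  refine ⟨a, b, hab, ?_, by omega⟩
  by_cases ha0 : a = 0
  · rw [ha0, natDegree_zero]; omega
  · rw [← natDegree_mul ha0 hp, eq_sub_of_add_eq hab]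
    refine (natDegree_sub_le _ _).trans (max_le hF ?_)
    exact natDegree_mul_le.trans (by omega)

/-- The integer polynomial obtained by rounding down the coefficients of a real polynomial. -/
noncomputable def floorPoly (a : ℝ[X]) : ℤ[X] :=
  ∑ k ∈ Finset.range (a.natDegree + 1), monomial k ⌊a.coeff k⌋

theorem coeff_floorPoly (a : ℝ[X]) (i : ℕ) : (floorPoly a).coeff i = ⌊a.coeff i⌋ := by
  rw [floorPoly, coeff_sum_range_monomial (fun k => ⌊a.coeff k⌋)]
  split_ifs with h
  · rfl
  · rw [coeff_eq_zero_of_natDegree_lt (by omega), Int.floor_zero]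

theorem natDegree_floorPoly_le (a : ℝ[X]) : (floorPoly a).natDegree ≤ a.natDegree :=
  natDegree_sum_range_monomial_le _ _

theorem natDegree_sub_floorPoly_le (a : ℝ[X]) :
    (a - (floorPoly a).map (Int.castRingHom ℝ)).natDegree ≤ a.natDegree :=
  (natDegree_sub_le _ _).trans (max_le le_rfl (natDegree_map_le.trans (natDegree_floorPoly_le a)))

theorem abs_coeff_sub_floorPoly_le (a : ℝ[X]) (i : ℕ) :
    |(a - (floorPoly a).map (Int.castRingHom ℝ)).coeff i| ≤ 1 := by
  rw [coeff_sub, coeff_map, coeff_floorPoly, eq_intCast, abs_le]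
  constructor <;> linarith [Int.floor_le (a.coeff i), Int.lt_floor_add_one (a.coeff i)]

theorem abs_coeff_mul_le {s p : ℝ[X]} {N : ℕ} (hN : s.natDegree + p.natDegree ≤ N) {B : ℝ}
    (hs : ∀ i, |s.coeff i| ≤ 1) (hp : ∀ i, |p.coeff i| ≤ B) (k : ℕ) :
    |(s * p).coeff k| ≤ (N + 1) * B := by
  have hB : 0 ≤ B := (abs_nonneg _).trans (hp 0)
  by_cases hk : k ≤ N
  · rw [coeff_mul]
    calc |∑ x ∈ Finset.HasAntidiagonal.antidiagonal k, s.coeff x.1 * p.coeff x.2|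
        ≤ ∑ x ∈ Finset.HasAntidiagonal.antidiagonal k, |s.coeff x.1 * p.coeff x.2| := Finset.abs_sum_le_sum_abs _ _
      _ ≤ ∑ x ∈ Finset.HasAntidiagonal.antidiagonal k, B := by
          refine Finset.sum_le_sum fun x _ => ?_
          rw [abs_mul]
          calc |s.coeff x.1| * |p.coeff x.2| ≤ 1 * B := by gcongr <;> apply_assumption
            _ = B := one_mul B
      _ = (k + 1) * B := by simp
      _ ≤ _ := by gcongr
  · rw [coeff_eq_zero_of_natDegree_lt (natDegree_mul_le.trans_lt (by omega)), abs_zero]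
    positivity

theorem natDegree_derivative_le_and_abs_coeff_le {p : ℝ[X]} {N : ℕ} (hN : p.natDegree ≤ N) {B : ℝ}
    (hp : ∀ i, |p.coeff i| ≤ B) :
    p.derivative.natDegree ≤ N ∧ ∀ i, |p.derivative.coeff i| ≤ N * B := by
  have hB : 0 ≤ B := (abs_nonneg _).trans (hp 0)
  have hdeg : p.derivative.natDegree ≤ N := (natDegree_derivative_le p).trans (by omega)
  refine ⟨hdeg, fun i => ?_⟩
  rw [coeff_derivative, abs_mul]
  by_cases hi : i + 1 ≤ N
  · rw [mul_comm, abs_of_nonneg (by positivity : (0 : ℝ) ≤ i + 1)]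
    have : (i : ℝ) + 1 ≤ N := by exact_mod_cast hi
    gcongr
    exact hp _
  · rw [coeff_eq_zero_of_natDegree_lt (by omega), abs_zero, zero_mul]
    positivity

/-- A polynomial that is small at `ζ` and whose derivative there is large compared with its
coefficients has a real root close to `ζ`. -/
theorem exists_root_near {p : ℝ[X]} {N : ℕ} (hN : p.natDegree ≤ N) {B D r ζ : ℝ}
    (hp : ∀ i, |p.coeff i| ≤ B) (hr0 : 0 < r) (hr1 : r ≤ 1) (hD : D ≤ p.derivative.eval ζ)
    (hr : (N + 1) * (N * (|ζ| + 1) ^ N) * (N * B) * r ≤ D / 2) (hv : |p.eval ζ| ≤ r * (D / 2)) :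
    ∃ α : ℝ, p.eval α = 0 ∧ |ζ - α| ≤ r := by
  have hB : 0 ≤ B := (abs_nonneg _).trans (hp 0)
  obtain ⟨hdeg, hcoeff⟩ := natDegree_derivative_le_and_abs_coeff_le hN hp
  have hder : ∀ t, |ζ - t| ≤ r → D / 2 ≤ p.derivative.eval t := by
    intro t ht
    have h1 := abs_eval_sub_eval_le hdeg hcoeff (ht.trans hr1)
    have h2 : (N + 1) * (N * (|ζ| + 1) ^ N) * (N * B) * |ζ - t| ≤ D / 2 := by
      refine le_trans ?_ hr
      gcongr
    have h3 := (abs_le.1 (h1.trans h2)).2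
    linarith
  have hmvt : ∀ s t : ℝ, s < t → |ζ - s| ≤ r → |ζ - t| ≤ r →
      (t - s) * (D / 2) ≤ p.eval t - p.eval s := by
    intro s t hst hs ht
    obtain ⟨c, hc, hc'⟩ := exists_deriv_eq_slope (fun x => p.eval x) hst
      p.continuous.continuousOn p.differentiable.differentiableOn
    rw [Polynomial.deriv] at hc'
    have hts : 0 < t - s := by linarith
    have hcr : |ζ - c| ≤ r := by
      rw [abs_le] at hs ht ⊢
      constructor <;> linarith [hc.1, hc.2]
    have := hder c hcr
    rw [hc', le_div_iff₀ hts] at this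
    linarith
  have hz : |ζ - ζ| ≤ r := by simpa using hr0.le
  have hplus : |ζ - (ζ + r)| ≤ r := by
    rw [show ζ - (ζ + r) = -r by ring, abs_neg, abs_of_pos hr0]
  have hminus : |ζ - (ζ - r)| ≤ r := by
    rw [show ζ - (ζ - r) = r by ring, abs_of_pos hr0]
  have h1 := hmvt ζ (ζ + r) (by linarith) hz hplus
  have h2 := hmvt (ζ - r) ζ (by linarith) hminus hz
  have h3 := abs_le.1 hv
  have hmem : (0 : ℝ) ∈ Set.Icc (p.eval (ζ - r)) (p.eval (ζ + r)) := by
    constructor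
    · have : (ζ - (ζ - r)) = r := by ring
      rw [this] at h2
      linarith
    · have : (ζ + r - ζ) = r := by ring
      rw [this] at h1
      linarith
  obtain ⟨α, hα, hα0⟩ := intermediate_value_Icc (by linarith : ζ - r ≤ ζ + r)
    (f := fun x => p.eval x) p.continuous.continuousOn hmem
  refine ⟨α, hα0, ?_⟩
  rw [abs_le]
  constructor <;> linarith [hα.1, hα.2]

theorem le_wHatStarExp {ζ : ℝ} {n : ℕ} {w : ℝ}
    (h : ∀ v < w, ∀ᶠ X : ℝ in atTop, ∃ (α : ℝ) (P : ℤ[X]), IsIntMinpoly α P ∧ P.natDegree ≤ n ∧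
      (polyHeight P : ℝ) ≤ X ∧ |ζ - α| ≤ (polyHeight P : ℝ)⁻¹ * X ^ (-v)) :
    (w : EReal) ≤ wHatStarExp n ζ := by
  refine EReal.ge_of_forall_gt_iff_ge.1 fun v hv => ?_
  exact le_sSup (Set.mem_image_of_mem _ (h v (EReal.coe_lt_coe_iff.1 hv)))

/-- Rational approximations show that `ŵ*_n(ζ) ≥ 1`. -/
theorem one_le_wHatStarExp (ζ : ℝ) {n : ℕ} (hn : 1 ≤ n) : 1 ≤ wHatStarExp n ζ := by
  rw [← EReal.coe_one]
  refine le_wHatStarExp fun v hv => ?_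
  -- Dirichlet: `ζ` is close to some `j / k` with `k ≤ X / (8 K)`. Since `j / k` need not be in
  -- lowest terms, the height of its minimal polynomial is bounded by Gelfond's inequality.
  set K : ℝ := |ζ| + 1 with hK
  have hK1 : 1 ≤ K := by linarith [abs_nonneg ζ]
  filter_upwards [eventually_ge_atTop (8 * K),
    eventually_mul_rpow_le (neg_lt_neg hv) (4 * K * 2 * (4 * K * 2))] with X hX hXv
  have hX0 : 0 < X := by linarith
  set M := ⌊X / (4 * K * 2)⌋₊ with hM
  have hM1 : 0 < M := Nat.floor_pos.2 (by rw [le_div_iff₀ (by positivity)]; linarith)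
  obtain ⟨j, k, hk0, hkM, hjk⟩ := Real.exists_int_int_abs_mul_sub_le ζ hM1
  have hk0' : (0 : ℝ) < k := by exact_mod_cast hk0
  have hk1 : (1 : ℝ) ≤ k := by exact_mod_cast hk0
  have hM0 : (0 : ℝ) ≤ M := Nat.cast_nonneg M
  have hMX : X / (4 * K * 2) < M + 1 := Nat.lt_floor_add_one _
  have hXM : (M : ℝ) ≤ X / (4 * K * 2) := Nat.floor_le (by positivity)
  set R : ℤ[X] := C k * Polynomial.X - C j with hR
  have hRdeg : R.natDegree ≤ 1 :=
    (natDegree_sub_le _ _).trans (max_le ((natDegree_C_mul_le _ _).trans natDegree_X_le) (by simp))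
  have hRc1 : R.coeff 1 = k := by
    rw [hR, coeff_sub, coeff_C_mul, coeff_X_one, coeff_C]; simp
  have hR0 : R ≠ 0 := by
    intro h0
    rw [h0, coeff_zero] at hRc1
    omega
  have hjK : |(j : ℝ)| ≤ 2 * K * k := by
    have h1 : |(k : ℝ) * ζ - j| ≤ 1 := hjk.trans (by rw [div_le_one (by positivity)]; linarith)
    have h2 : |(j : ℝ)| ≤ |(k : ℝ) * ζ| + |(k : ℝ) * ζ - j| := by
      have := abs_sub ((k : ℝ) * ζ) ((k : ℝ) * ζ - j)
      simpa using this
    rw [abs_mul, abs_of_pos hk0'] at h2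
    nlinarith [abs_nonneg ζ]
  have hRH : (polyHeight R : ℝ) ≤ 2 * K * k := by
    refine polyHeight_le (by positivity) fun i => ?_
    match i with
    | 0 => simpa [hR] using hjK
    | 1 => rw [hRc1, abs_of_pos hk0']; nlinarith
    | i + 2 =>
      rw [coeff_eq_zero_of_natDegree_lt (by omega), Int.cast_zero, abs_zero]
      positivity
  have hroot : aeval ((j : ℝ) / k) R = 0 := by
    simp [hR, mul_div_cancel₀ _ hk0'.ne']
  obtain ⟨P, hP, hPR⟩ := exists_isIntMinpoly hR0 hroot
  have hP1 := one_le_polyHeight hP.1.ne_zero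
  have hPH : (polyHeight P : ℝ) ≤ 4 * K * 2 * k := by
    have := polyHeight_le_of_dvd hPR hR0 hRdeg
    norm_num at this
    linarith
  refine ⟨j / k, P, hP, ((natDegree_le_of_dvd hPR hR0).trans hRdeg).trans hn, ?_, ?_⟩
  · have hkM' : (k : ℝ) ≤ M := by exact_mod_cast hkM
    calc (polyHeight P : ℝ) ≤ 4 * K * 2 * k := hPH
      _ ≤ 4 * K * 2 * (X / (4 * K * 2)) := by gcongr; linarith
      _ = X := by field_simp
  · have h1 : |ζ - j / k| = |k * ζ - j| / k := by
      rw [← abs_of_pos hk0', ← abs_div, abs_of_pos hk0']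
      congr 1
      field_simp
    rw [h1]
    calc |k * ζ - j| / k ≤ (1 / (M + 1)) / k := by gcongr
      _ ≤ (1 / (X / (4 * K * 2))) / k := by gcongr
      _ = (k : ℝ)⁻¹ * (4 * K * 2 * X⁻¹) := by field_simp
      _ ≤ (4 * K * 2 * (polyHeight P : ℝ)⁻¹) * (4 * K * 2 * X⁻¹) := by
        gcongr
        rw [← div_eq_mul_inv, inv_le_comm₀ hk0' (by positivity), inv_div,
          div_le_iff₀ (by positivity)]
        linarith
      _ = (polyHeight P : ℝ)⁻¹ * (4 * K * 2 * (4 * K * 2) * X ^ (-1 : ℝ)) := by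
        rw [Real.rpow_neg_one]; ring
      _ ≤ _ := by gcongr

/-- A real combination of the products of two coprime polynomials by powers of `T` is a large
multiple of `T - ζ`; rounding the coefficients of the cofactors gives an integer polynomial that is
small at `ζ` and whose derivative there is as large as its height, up to a constant. -/
theorem exists_large_derivative {N : ℕ} (hN : 1 ≤ N) (ζ : ℝ) :
    ∃ K : ℝ, 0 < K ∧ ∀ (P Q : ℤ[X]) (B ε : ℝ), P ≠ 0 →
      IsCoprime (P.map (Int.castRingHom ℝ)) (Q.map (Int.castRingHom ℝ)) →
      P.natDegree + Q.natDegree ≤ N → 0 < B → (polyHeight P : ℝ) ≤ B → (polyHeight Q : ℝ) ≤ B →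
      |aeval ζ P| ≤ ε → |aeval ζ Q| ≤ ε →
      ∃ R : ℤ[X], R.natDegree ≤ N ∧ (polyHeight R : ℝ) ≤ K * B ∧ |aeval ζ R| ≤ K * ε ∧
        B ≤ (R.map (Int.castRingHom ℝ)).derivative.eval ζ := by
  set A := absPowSum ζ N with hA
  have hA1 : 1 ≤ A := one_le_absPowSum ζ N
  -- `K₂ B` bounds the coefficients of the rounding error, and `L B` is the factor of `T - ζ`.
  set K₂ : ℝ := 2 * (N + 1) with hK₂
  have hK₂0 : 0 ≤ K₂ := by positivity
  set L : ℝ := A * (N * K₂) + 1 with hL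
  have hL0 : 0 < L := by positivity
  refine ⟨L * (1 + |ζ|) + K₂ + 2 * A, by positivity,
    fun P Q B ε hP0 hcop hPQ hB hPH hQH hPv hQv => ?_⟩
  set p := P.map (Int.castRingHom ℝ) with hp
  set q := Q.map (Int.castRingHom ℝ) with hq
  have hp0 : p ≠ 0 := (Polynomial.map_ne_zero_iff (RingHom.injective_int _)).2 hP0
  have hpn : p.natDegree = P.natDegree := natDegree_map_eq_of_injective (RingHom.injective_int _) _
  have hqm : q.natDegree = Q.natDegree := natDegree_map_eq_of_injective (RingHom.injective_int _) _
  have hpc : ∀ i, |p.coeff i| ≤ B := fun i => by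
    rw [hp, coeff_map]; exact (abs_coeff_le_polyHeight P i).trans hPH
  have hqc : ∀ i, |q.coeff i| ≤ B := fun i => by
    rw [hq, coeff_map]; exact (abs_coeff_le_polyHeight Q i).trans hQH
  rw [aeval_eq_eval_map] at hPv hQv
  have hε : 0 ≤ ε := (abs_nonneg _).trans hPv
  set F : ℝ[X] := C (L * B) * (X - C ζ) with hF
  have hFN : F.natDegree ≤ N :=
    (natDegree_C_mul_le _ _).trans ((natDegree_X_sub_C_le ζ).trans hN)
  obtain ⟨a, b, hab, han, hbn⟩ := exists_mul_add_mul_eq hp0 hcop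
    (show p.natDegree + q.natDegree ≤ N by omega) hFN
  set s := a - (floorPoly a).map (Int.castRingHom ℝ) with hs
  set t := b - (floorPoly b).map (Int.castRingHom ℝ) with ht
  have hsn : s.natDegree ≤ a.natDegree := natDegree_sub_floorPoly_le a
  have htn : t.natDegree ≤ b.natDegree := natDegree_sub_floorPoly_le b
  have hsc : ∀ i, |s.coeff i| ≤ 1 := abs_coeff_sub_floorPoly_le a
  have htc : ∀ i, |t.coeff i| ≤ 1 := abs_coeff_sub_floorPoly_le b
  set G := s * p + t * q with hG
  have hGN : G.natDegree ≤ N :=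
    (natDegree_add_le _ _).trans (max_le (natDegree_mul_le.trans (by omega))
      (natDegree_mul_le.trans (by omega)))
  have hGc : ∀ i, |G.coeff i| ≤ K₂ * B := by
    intro i
    have h1 := abs_coeff_mul_le (N := N) (by omega) hsc hpc i
    have h2 := abs_coeff_mul_le (N := N) (by omega) htc hqc i
    rw [hG, coeff_add]
    calc _ ≤ _ := abs_add_le _ _
      _ ≤ (N + 1) * B + (N + 1) * B := add_le_add h1 h2
      _ = K₂ * B := by rw [hK₂]; ring
  set R : ℤ[X] := floorPoly a * P + floorPoly b * Q with hR
  have hRmap : R.map (Int.castRingHom ℝ) = F - G := by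
    rw [hR, Polynomial.map_add, Polynomial.map_mul, Polynomial.map_mul, hG, ← hab, hs, ht]
    ring
  have hFc : ∀ i, |F.coeff i| ≤ L * B * (1 + |ζ|) := by
    intro i
    rw [hF, coeff_C_mul, abs_mul, abs_of_nonneg (by positivity : 0 ≤ L * B)]
    gcongr
    rw [coeff_sub, coeff_X, coeff_C]
    refine (abs_sub _ _).trans (add_le_add ?_ ?_)
    · split_ifs <;> simp
    · split_ifs <;> simp
  refine ⟨R, ?_, polyHeight_le (by positivity) fun i => ?_, ?_, ?_⟩
  · have : (R.map (Int.castRingHom ℝ)).natDegree ≤ N := by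
      rw [hRmap]; exact (natDegree_sub_le _ _).trans (max_le hFN hGN)
    rwa [natDegree_map_eq_of_injective (RingHom.injective_int _)] at this
  · have h1 : (R.coeff i : ℝ) = F.coeff i - G.coeff i := by
      rw [← coeff_sub, ← hRmap]; simp
    rw [h1]
    calc _ ≤ _ := abs_sub _ _
      _ ≤ L * B * (1 + |ζ|) + K₂ * B := add_le_add (hFc i) (hGc i)
      _ = (L * (1 + |ζ|) + K₂) * B := by ring
      _ ≤ _ := mul_le_mul_of_nonneg_right (by linarith) hB.le
  · have hFv : F.eval ζ = 0 := by simp [hF]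
    have hsv := abs_eval_le (n := N) (by omega) hsc ζ
    have htv := abs_eval_le (n := N) (by omega) htc ζ
    rw [aeval_eq_eval_map, hRmap, eval_sub, hFv, zero_sub, abs_neg, hG, eval_add, eval_mul,
      eval_mul]
    calc _ ≤ _ := abs_add_le _ _
      _ ≤ A * 1 * ε + A * 1 * ε := by
        rw [abs_mul, abs_mul]
        gcongr
      _ = 2 * A * ε := by ring
      _ ≤ _ := by
        have : 0 ≤ L * (1 + |ζ|) + K₂ := by positivity
        gcongr; linarith
  · have hFd : F.derivative.eval ζ = L * B := by simp [hF]
    obtain ⟨h1, h2⟩ := natDegree_derivative_le_and_abs_coeff_le hGN hGc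
    have h3 := (abs_le.1 (abs_eval_le h1 h2 ζ)).2
    rw [hRmap, derivative_sub, eval_sub, hFd, hL]
    linarith

/-- If `m ≥ w + n` for some `w > w_n(ζ)`, then `ŵ*_{n+m}(ζ) ≥ n`. -/
theorem natCast_le_wHatStarExp {ζ : ℝ} (hζ : Transcendental ℚ ζ) {n m : ℕ} (hn : 1 ≤ n) {w : ℝ}
    (hw0 : 0 ≤ w) (hw : wExp n ζ < w) (hm : w + n ≤ m) :
    (n : EReal) ≤ wHatStarExp (n + m) ζ := by
  obtain ⟨K, hK1, hpair⟩ := exists_coprime_pair hζ hw0 hw hm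
  rw [show (n : EReal) = ((n : ℝ) : EReal) by simp]
  refine le_wHatStarExp fun v hv => ?_
  set N := n + m with hN
  obtain ⟨K₃, hK₃, hlarge⟩ := exists_large_derivative (show 1 ≤ N by omega) ζ
  set K₄ : ℝ := 2 ^ N * ((N + 1) * (K₃ * K)) with hK₄
  have hK₄0 : 0 < K₄ := by positivity
  have hYlim : Tendsto (fun X : ℝ => X / K₄) atTop atTop := tendsto_id.atTop_div_const hK₄0
  set K₅ : ℝ := 2 * K₃ with hK₅
  have hK₅0 : 0 < K₅ := by positivity
  have hn1 : (0 : ℝ) < n + 1 := by positivity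
  have hrlim : Tendsto (fun Y : ℝ => K₅ * Y ^ (-(n : ℝ) - 1)) atTop (nhds 0) := by
    have := (tendsto_rpow_neg_atTop hn1).const_mul K₅
    rw [mul_zero] at this
    simpa only [neg_add'] using this
  set K₆ : ℝ := (N + 1) * (N * (|ζ| + 1) ^ N) * (N * K₃) with hK₆
  have hK₆0 : 0 ≤ K₆ := by positivity
  have hrlim2 : Tendsto (fun Y : ℝ => K₆ * (K₅ * Y ^ (-(n : ℝ) - 1))) atTop (nhds 0) := by
    simpa only [mul_zero] using hrlim.const_mul K₆
  filter_upwards [hYlim.eventually_ge_atTop 1, hYlim.eventually (hrlim.eventually_le_const one_pos),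
    hYlim.eventually (hrlim2.eventually_le_const (show (0 : ℝ) < 1 / 2 by norm_num)),
    eventually_mul_rpow_le (show (-(n : ℝ) - 1) < -v - 1 by linarith) (K₅ * (K₄⁻¹) ^ (-(n : ℝ) - 1)),
    eventually_gt_atTop 0] with X hY1 hr1 hr2 hXv hX0
  set Y := X / K₄ with hY
  have hY0 : 0 < Y := by linarith
  set r := K₅ * Y ^ (-(n : ℝ) - 1) with hr
  have hr0 : 0 < r := by positivity
  obtain ⟨P, Q, hP0, -, hcop, hPn, hQm, hPH, hQH, hPv, hQv⟩ := hpair Y hY1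
  have hKY : 0 < K * Y := by positivity
  obtain ⟨R, hRN, hRH, hRv, hRder⟩ := hlarge P Q (K * Y) _ hP0 hcop (by omega) hKY hPH hQH hPv hQv
  have hRc : ∀ i, |(R.map (Int.castRingHom ℝ)).coeff i| ≤ K₃ * (K * Y) := fun i => by
    rw [coeff_map]; exact (abs_coeff_le_polyHeight R i).trans hRH
  obtain ⟨α, hα, hαr⟩ := exists_root_near ((natDegree_map_le).trans hRN) hRc hr0 hr1 hRder (by
    calc _ = K₆ * r * (K * Y) := by rw [hK₆]; ring
      _ ≤ 1 / 2 * (K * Y) := by gcongr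
      _ = K * Y / 2 := by ring) (by
    rw [← aeval_eq_eval_map]
    refine hRv.trans (le_of_eq ?_)
    rw [hr, hK₅, Real.rpow_sub_one hY0.ne']
    field_simp)
  have hR0 : R ≠ 0 := by
    rintro rfl
    simp at hRder
    linarith
  rw [← aeval_eq_eval_map] at hα
  obtain ⟨S, hS, hSR⟩ := exists_isIntMinpoly hR0 hα
  have hSH : (polyHeight S : ℝ) ≤ X := by
    refine (polyHeight_le_of_dvd hSR hR0 hRN).trans ?_
    calc (2 : ℝ) ^ N * ((N + 1) * polyHeight R) ≤ 2 ^ N * ((N + 1) * (K₃ * (K * Y))) := by gcongr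
      _ = K₄ * Y := by rw [hK₄]; ring
      _ = X := by rw [hY]; field_simp
  have hS1 := one_le_polyHeight hS.1.ne_zero
  refine ⟨α, S, hS, (natDegree_le_of_dvd hSR hR0).trans hRN, hSH, hαr.trans ?_⟩
  calc r = K₅ * (K₄⁻¹) ^ (-(n : ℝ) - 1) * X ^ (-(n : ℝ) - 1) := by
        rw [hr, hY, div_eq_inv_mul, Real.mul_rpow (by positivity) hX0.le]
        ring
    _ ≤ X ^ (-v - 1) := hXv
    _ = X⁻¹ * X ^ (-v) := by rw [Real.rpow_sub_one hX0.ne']; ring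
    _ ≤ _ := by gcongr

/-! ### Linear functionals on polynomials of bounded degree -/

/-- The linear functional on real polynomials of degree at most `N` that maps `T ^ i` to `y i`. -/
noncomputable def momentMap (N : ℕ) (y : ℕ → ℝ) : ℝ[X] →ₗ[ℝ] ℝ :=
  ∑ i ∈ Finset.range (N + 1), y i • lcoeff ℝ i

theorem momentMap_apply (N : ℕ) (y : ℕ → ℝ) (p : ℝ[X]) :
    momentMap N y p = ∑ i ∈ Finset.range (N + 1), y i * p.coeff i := by
  simp [momentMap]

theorem momentMap_X_pow {N i : ℕ} (hi : i ≤ N) (y : ℕ → ℝ) : momentMap N y (X ^ i) = y i := by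
  rw [momentMap_apply, Finset.sum_eq_single i]
  · simp
  · intro j _ hj
    simp [coeff_X_pow, hj]
  · intro h
    exact absurd (Finset.mem_range.2 (by omega)) h

theorem abs_momentMap_sub_le {N : ℕ} {y : ℕ → ℝ} {x ζ ε B : ℝ}
    (hy : ∀ i ≤ N, |ζ ^ i * x - y i| ≤ ε) {p : ℝ[X]} (hN : p.natDegree ≤ N)
    (hp : ∀ i, |p.coeff i| ≤ B) : |momentMap N y p - x * p.eval ζ| ≤ (N + 1) * (B * ε) := by
  have hB : 0 ≤ B := (abs_nonneg _).trans (hp 0)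
  rw [momentMap_apply, eval_eq_sum_range_of_le hN, Finset.mul_sum, ← Finset.sum_sub_distrib]
  calc _ ≤ ∑ i ∈ Finset.range (N + 1), |y i * p.coeff i - x * (p.coeff i * ζ ^ i)| :=
        Finset.abs_sum_le_sum_abs _ _
    _ ≤ ∑ i ∈ Finset.range (N + 1), B * ε := by
        refine Finset.sum_le_sum fun i hi => ?_
        have hi' : i ≤ N := by simpa [Nat.lt_succ_iff] using hi
        rw [show y i * p.coeff i - x * (p.coeff i * ζ ^ i) = p.coeff i * -(ζ ^ i * x - y i) by ring,
          abs_mul, abs_neg]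
        exact mul_le_mul (hp i) (hy i hi') (abs_nonneg _) hB
    _ = _ := by simp

theorem momentMap_mul_eq_zero {N : ℕ} {y : ℕ → ℝ} {a p : ℝ[X]} {d : ℕ}
    (h : ∀ j, j + d ≤ N → momentMap N y (X ^ j * p) = 0) (ha : a.natDegree + d ≤ N) :
    momentMap N y (a * p) = 0 := by
  rw [a.as_sum_range_C_mul_X_pow, Finset.sum_mul, map_sum]
  refine Finset.sum_eq_zero fun j hj => ?_
  have hj' : j ≤ a.natDegree := by simpa [Nat.lt_succ_iff] using hj
  rw [mul_assoc, C_mul', map_smul, h j (by omega), smul_zero]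

theorem momentMap_intCast (N : ℕ) (y : ℕ → ℤ) (P : ℤ[X]) :
    momentMap N (fun i => y i) (P.map (Int.castRingHom ℝ)) =
      ((∑ i ∈ Finset.range (N + 1), y i * P.coeff i : ℤ) : ℝ) := by
  rw [momentMap_apply]
  push_cast
  simp only [coeff_map, eq_intCast]

theorem abs_momentMap_X_pow_mul_le {N : ℕ} {y : ℕ → ℝ} {x ζ ε η : ℝ} {P : ℤ[X]}
    (hy : ∀ i ≤ N, |ζ ^ i * x - y i| ≤ ε) (hP : |x| * |aeval ζ P| ≤ η) {j : ℕ}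
    (hj : j + P.natDegree ≤ N) :
    |momentMap N y ((X ^ j * P).map (Int.castRingHom ℝ))| ≤
      (N + 1) * (polyHeight P * ε) + absPowSum ζ N * η := by
  set p : ℝ[X] := (X ^ j * P).map (Int.castRingHom ℝ) with hp
  have hpN : p.natDegree ≤ N := natDegree_map_le.trans
    (natDegree_mul_le.trans ((add_le_add (natDegree_X_pow_le j) le_rfl).trans hj))
  have hpc : ∀ i, |p.coeff i| ≤ polyHeight P := by
    intro i
    rw [hp, coeff_map, coeff_X_pow_mul']
    split_ifs with h
    · exact abs_coeff_le_polyHeight P _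
    · simp
  have h1 := abs_momentMap_sub_le hy hpN hpc
  have h2 : |x * p.eval ζ| ≤ absPowSum ζ N * η := by
    rw [hp, ← aeval_eq_eval_map, map_mul, map_pow, aeval_X, abs_mul, abs_mul, abs_pow]
    calc |x| * (|ζ| ^ j * |aeval ζ P|) = |ζ| ^ j * (|x| * |aeval ζ P|) := by ring
      _ ≤ _ := by
        have := one_le_absPowSum ζ N
        gcongr
        exact abs_pow_le_absPowSum ζ (by omega)
  have := abs_add_le (momentMap N y p - x * p.eval ζ) (x * p.eval ζ)
  rw [sub_add_cancel] at this
  linarith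

/-- If the integers `y i` approximate `ζ ^ i * x` well, and `P` is small at `ζ`, then the functional
given by the `y i` vanishes at the multiples of `P`, because it takes integer values there. -/
theorem momentMap_X_pow_mul_eq_zero {N : ℕ} {y : ℕ → ℤ} {x ζ ε η : ℝ} {P : ℤ[X]}
    (hy : ∀ i ≤ N, |ζ ^ i * x - y i| ≤ ε) (hP : |x| * |aeval ζ P| ≤ η)
    (hsmall : (N + 1) * (polyHeight P * ε) + absPowSum ζ N * η < 1) {j : ℕ}
    (hj : j + P.natDegree ≤ N) :
    momentMap N (fun i => y i) (X ^ j * P.map (Int.castRingHom ℝ)) = 0 := by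
  have h := (abs_momentMap_X_pow_mul_le hy hP hj).trans_lt hsmall
  have hmap : X ^ j * P.map (Int.castRingHom ℝ) = (X ^ j * P).map (Int.castRingHom ℝ) := by simp
  rw [hmap]
  rw [momentMap_intCast] at h ⊢
  have h4 : |∑ i ∈ Finset.range (N + 1), y i * (X ^ j * P).coeff i| < 1 := by exact_mod_cast h
  rw [Int.abs_lt_one_iff.1 h4, Int.cast_zero]

/-! ### Upper bounds for `λ_n` -/

/-- The index `0`, where the error is `0`, is included among the approximations. -/
theorem exists_of_lt_lamExp {n : ℕ} {ζ l : ℝ} (h : (l : EReal) < lamExp n ζ) :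
    ∃ᶠ X : ℝ in atTop, ∃ (x : ℤ) (y : ℕ → ℤ), 1 ≤ |(x : ℝ)| ∧ |(x : ℝ)| ≤ X ∧ y 0 = x ∧
      ∀ i ≤ n, |ζ ^ i * (x : ℝ) - (y i : ℝ)| ≤ X ^ (-l) := by
  obtain ⟨_, ⟨v, hv, rfl⟩, hlv⟩ := lt_sSup_iff.1 h
  have hlv' : l < v := EReal.coe_lt_coe_iff.1 hlv
  refine Frequently.mp hv ?_
  filter_upwards [eventually_ge_atTop 1] with X hX
  rintro ⟨x, y, hx1, hxX, hy⟩
  refine ⟨x, fun i => if i = 0 then x else y i, hx1, hxX, rfl, fun i hi => ?_⟩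
  rcases Nat.eq_zero_or_pos i with rfl | hi0
  · simp only [pow_zero, one_mul, if_true, sub_self, abs_zero]
    positivity
  · simp only [hi0.ne', if_false]
    exact (hy i (Finset.mem_Icc.2 ⟨hi0, hi⟩)).trans
      (Real.rpow_le_rpow_of_exponent_le hX (by linarith))

/-- If `m ≥ w + n` for some `w > w_n(ζ)`, then `λ_{n+m}(ζ) ≤ 1 / n`: better approximations would
give a functional vanishing at all the multiples of both members of a coprime pair, hence at `1`. -/
theorem lamExp_le {ζ : ℝ} (hζ : Transcendental ℚ ζ) {n m : ℕ} (hn : 1 ≤ n) {w : ℝ} (hw0 : 0 ≤ w)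
    (hw : wExp n ζ < w) (hm : w + n ≤ m) : lamExp (n + m) ζ ≤ ((1 / n : ℝ) : EReal) := by
  by_contra! hlt
  obtain ⟨K, hK1, hpair⟩ := exists_coprime_pair hζ hw0 hw hm
  obtain ⟨l, hl1, hl2⟩ := EReal.lt_iff_exists_real_btwn.1 hlt
  have hn0 : (0 : ℝ) < n := by exact_mod_cast hn
  have hl : 1 / (n : ℝ) < l := EReal.coe_lt_coe_iff.1 hl1
  have hl0 : 0 < l := lt_trans (by positivity) hl
  have hln : 1 - l * n < 0 := by rw [div_lt_iff₀ hn0] at hl; linarith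
  set N := n + m with hN
  set A := absPowSum ζ N with hA
  have hA1 : 1 ≤ A := one_le_absPowSum ζ N
  set K₂ : ℝ := 4 * ((N + 1) * K) with hK₂
  have hK₂0 : 0 < K₂ := by positivity
  set K₃ : ℝ := K * K₂ ^ (n : ℝ) with hK₃
  have hlim : Tendsto (fun X : ℝ => A * (K₃ * X ^ (1 - l * n))) atTop (nhds 0) := by
    have := ((tendsto_rpow_neg_atTop (y := -(1 - l * n)) (by linarith)).const_mul K₃).const_mul A
    simpa only [neg_neg, mul_zero] using this
  obtain ⟨X, ⟨x, y, hx1, hxX, hy0, hy⟩, ⟨hX1, hX2⟩, hX3⟩ :=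
    ((exists_of_lt_lamExp hl2).and_eventually
      (((tendsto_rpow_atTop hl0).eventually_ge_atTop K₂).and
        (hlim.eventually_lt_const (show (0 : ℝ) < 1 / 2 by norm_num)) |>.and
        (eventually_gt_atTop 0))).exists
  set Y := X ^ l / K₂ with hY
  have hXl : 0 < X ^ l := by positivity
  have hY1 : 1 ≤ Y := by rwa [hY, one_le_div hK₂0]
  have hY0 : 0 < Y := by linarith
  obtain ⟨P, Q, hP0, hQ0, hcop, hPn, hQm, hPH, hQH, hPv, hQv⟩ := hpair Y hY1
  -- The values of the functional at multiples of `P` and `Q` are integers of modulus less than `1`.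
  have hval : ∀ S : ℤ[X], |aeval ζ S| ≤ K * Y ^ (-(n : ℝ)) →
      |(x : ℝ)| * |aeval ζ S| ≤ K₃ * X ^ (1 - l * n) := by
    intro S hS
    calc |(x : ℝ)| * |aeval ζ S| ≤ X * (K * Y ^ (-(n : ℝ))) := by gcongr
      _ = K₃ * X ^ (1 - l * n) := by
        rw [hY, Real.div_rpow hXl.le hK₂0.le, ← Real.rpow_mul hX3.le,
          Real.rpow_neg hK₂0.le, hK₃, sub_eq_add_neg, Real.rpow_add hX3, Real.rpow_one]
        rw [div_inv_eq_mul]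
        ring_nf
  have hheight : ∀ S : ℤ[X], (polyHeight S : ℝ) ≤ K * Y →
      (N + 1) * (polyHeight S * X ^ (-l)) ≤ (1 / 4 : ℝ) := by
    intro S hS
    calc (N + 1) * (polyHeight S * X ^ (-l)) ≤ (N + 1) * (K * Y * X ^ (-l)) := by gcongr
      _ = 1 / 4 := by
        rw [hY, Real.rpow_neg hX3.le, hK₂]
        field_simp
  have hzero : ∀ S : ℤ[X], (polyHeight S : ℝ) ≤ K * Y → |aeval ζ S| ≤ K * Y ^ (-(n : ℝ)) →
      ∀ j, j + S.natDegree ≤ N →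
        momentMap N (fun i => y i) (Polynomial.X ^ j * S.map (Int.castRingHom ℝ)) = 0 :=
    fun S hSH hSv j hj => momentMap_X_pow_mul_eq_zero hy (hval S hSv)
      (by linarith [hheight S hSH]) hj
  obtain ⟨a, b, hab, han, hbn⟩ := exists_mul_add_mul_eq (F := 1)
    ((Polynomial.map_ne_zero_iff (RingHom.injective_int _)).2 hP0) hcop
    (N := N) ((add_le_add natDegree_map_le natDegree_map_le).trans (by omega)) (by simp)
  rw [natDegree_map_eq_of_injective (RingHom.injective_int _)] at han hbn
  have h1 := momentMap_X_pow (Nat.zero_le N) (fun i => (y i : ℝ))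
  rw [pow_zero, ← hab, map_add, momentMap_mul_eq_zero (hzero P hPH hPv) han,
    momentMap_mul_eq_zero (hzero Q hQH hQv) hbn, add_zero] at h1
  rw [← hy0, ← h1, abs_zero] at hx1
  linarith

/-- The exponents `λ_n(ζ)` are bounded if `ζ` is not a Liouville number. -/
theorem exists_lamExp_le_of_not_liouville {ζ : ℝ} (hζ : Transcendental ℚ ζ) (h : ¬ Liouville ζ) :
    ∃ C : ℝ, 0 < C ∧ ∀ n, 1 ≤ n → lamExp n ζ ≤ C := by
  have hirr : Irrational ζ := hζ.irrational
  simp only [Liouville, not_forall, not_exists, not_and, not_lt] at h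
  obtain ⟨k, hk⟩ := h
  refine ⟨k + 1, by positivity, fun n hn => ?_⟩
  by_contra! hlt
  obtain ⟨l, hl1, hl2⟩ := EReal.lt_iff_exists_real_btwn.1 hlt
  have hl : (k : ℝ) + 1 < l := by exact_mod_cast hl1
  have hk0 : (0 : ℝ) ≤ k := Nat.cast_nonneg k
  obtain ⟨X, ⟨x, y, hx1, hxX, hy0, hy⟩, hX⟩ :=
    ((exists_of_lt_lamExp hl2).and_eventually
      (eventually_gt_atTop ((2 : ℝ) ^ k))).exists
  have hX1 : 1 ≤ X := hx1.trans hxX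
  have h1 := hy 1 hn
  rw [pow_one] at h1
  have hx0 : (0 : ℝ) < |(x : ℝ)| := by linarith
  have hxne : (x : ℝ) ≠ 0 := abs_pos.1 hx0
  -- Multiplying numerator and denominator by `2` makes the denominator exceed `1`.
  have hxZ : 1 ≤ |x| := by exact_mod_cast hx1
  have h2 := hk (2 * (x.sign * y 1)) (2 * |x|) (by omega)
  have hfrac : ((2 * (x.sign * y 1) : ℤ) : ℝ) / ((2 * |x| : ℤ) : ℝ) = y 1 / x := by
    rcases lt_or_gt_of_ne (show x ≠ 0 by exact_mod_cast hxne) with hneg | hpos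
    · rw [Int.sign_eq_neg_one_of_neg hneg, abs_of_neg hneg]
      push_cast
      field_simp
    · rw [Int.sign_eq_one_of_pos hpos, abs_of_pos hpos]
      push_cast
      field_simp
  rw [hfrac] at h2
  have h3 := h2 (by
    intro heq
    exact hirr ⟨(y 1 : ℚ) / x, by rw [heq]; push_cast; rfl⟩)
  have h4 : |ζ - y 1 / x| = |ζ * x - y 1| / |(x : ℝ)| := by
    rw [← abs_div]; congr 1; field_simp
  rw [h4] at h3
  push_cast at h3
  have h5 : |ζ * x - y 1| ≤ (|(x : ℝ)| ^ k * X)⁻¹ := by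
    refine h1.trans ?_
    calc X ^ (-l) ≤ X ^ (-((k + 1 : ℕ) : ℝ)) :=
          Real.rpow_le_rpow_of_exponent_le hX1 (by push_cast; linarith)
      _ = (X ^ k * X)⁻¹ := by rw [Real.rpow_neg (by linarith), Real.rpow_natCast, pow_succ]
      _ ≤ _ := by gcongr
  have h6 : 1 / (2 * |(x : ℝ)|) ^ k ≤ (|(x : ℝ)| ^ k * X)⁻¹ := by
    refine h3.trans ((div_le_self (abs_nonneg _) hx1).trans h5)
  rw [one_div, inv_le_inv₀ (by positivity) (by positivity), mul_pow,
    mul_comm ((2 : ℝ) ^ k)] at h6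
  have := le_of_mul_le_mul_left h6 (by positivity : 0 < |(x : ℝ)| ^ k)
  linarith

/-! ### Lower bound for `λ_n` -/

/-- The case of a spanning family of `exists_subfamily_bounded_coeff`. -/
theorem exists_subfamily_bounded_coeff_of_span_eq_top {W ι : Type*} [AddCommGroup W] [Module ℝ W]
    [FiniteDimensional ℝ W] [Finite ι] (v : ι → W) (hv : Submodule.span ℝ (Set.range v) = ⊤) :
    ∃ (r : ℕ) (f : Fin r → ι), r ≤ Module.finrank ℝ W ∧
      ∀ i, ∃ c : Fin r → ℝ, (∀ k, |c k| ≤ 1) ∧ v i = ∑ k, c k • v (f k) := by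
  obtain ⟨g, hgmem, hgspan, hgli⟩ := Submodule.exists_fun_fin_finrank_span_eq ℝ (Set.range v)
  choose f₀ hf₀ using hgmem
  have hg : g = v ∘ f₀ := funext fun k => (hf₀ k).symm
  let b := Module.Basis.mk hgli (hgspan.trans hv).ge
  have : Nonempty (Fin _ → ι) := ⟨f₀⟩
  obtain ⟨f, hf⟩ := Finite.exists_max fun f : Fin _ → ι => |b.det (v ∘ f)|
  have hdet : b.det (v ∘ f) ≠ 0 := by
    intro h0
    have h1 := hf f₀
    have h2 : (v ∘ f₀) = b := by rw [← hg, Module.Basis.coe_mk]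
    rw [h0, h2, b.det_self] at h1
    norm_num at h1
  obtain ⟨hli, hsp⟩ := b.is_basis_iff_det.2 (isUnit_iff_ne_zero.2 hdet)
  refine ⟨_, f, Submodule.finrank_le _, fun i => ?_⟩
  let e := Module.Basis.mk hli hsp.ge
  refine ⟨fun k => e.coord k (v i), fun k => ?_, ?_⟩
  · -- Cramer's rule: the coefficient is a quotient of two determinants of subfamilies.
    have h1 := LinearMap.congr_fun (b.det_smul_mk_coord_eq_det_update hli hsp.ge k) (v i)
    have h2 : b.det (v ∘ f) * e.coord k (v i) = b.det (v ∘ Function.update f k i) := by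
      rw [Function.comp_update]
      exact h1
    have h3 := hf (Function.update f k i)
    rw [← h2, abs_mul] at h3
    exact (mul_le_iff_le_one_right (abs_pos.2 hdet)).1 h3
  · have h1 := e.sum_repr (v i)
    have h2 : ∀ k, e k = v (f k) := fun k => by simp [e]
    simp only [h2] at h1
    exact h1.symm

/-- A finite family of vectors contains a subfamily, of size at most the dimension, in terms of
which all its members can be written with coefficients in `[-1, 1]`: take a subfamily of maximal
determinant. -/
theorem exists_subfamily_bounded_coeff {W ι : Type*} [AddCommGroup W] [Module ℝ W]
    [FiniteDimensional ℝ W] [Finite ι] (v : ι → W) :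
    ∃ (r : ℕ) (f : Fin r → ι), r ≤ Module.finrank ℝ W ∧
      ∀ i, ∃ c : Fin r → ℝ, (∀ k, |c k| ≤ 1) ∧ v i = ∑ k, c k • v (f k) := by
  obtain ⟨r, f, hr, h⟩ := exists_subfamily_bounded_coeff_of_span_eq_top
    (fun i => (⟨v i, Submodule.subset_span ⟨i, rfl⟩⟩ : Submodule.span ℝ (Set.range v)))
    (Submodule.span_range_subtype_eq_top_iff _ _ |>.2 rfl)
  refine ⟨r, f, hr.trans (Submodule.finrank_le _), fun i => ?_⟩
  obtain ⟨c, hc, hi⟩ := h i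
  refine ⟨c, hc, ?_⟩
  simpa using congrArg Subtype.val hi

/-- Modulo a nonzero polynomial `p`, all the `T ^ i - ζ ^ i` with `i ≤ N` are combinations, with
coefficients in `[-1, 1]`, of at most `p.natDegree` of them. -/
theorem exists_bounded_reduction {p : ℝ[X]} (hp : p ≠ 0) (ζ : ℝ) (N : ℕ) :
    ∃ (r : ℕ) (f : Fin r → ℕ), r ≤ p.natDegree ∧ (∀ k, f k ≤ N) ∧
      ∀ i ≤ N, ∃ (c : Fin r → ℝ) (a : ℝ[X]), (∀ k, |c k| ≤ 1) ∧
        (a = 0 ∨ a.natDegree + p.natDegree ≤ N) ∧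
        X ^ i - C (ζ ^ i) = ∑ k, c k • (X ^ f k - C (ζ ^ f k)) + a * p := by
  have : FiniteDimensional ℝ (AdjoinRoot p) := (AdjoinRoot.powerBasis hp).finite
  obtain ⟨r, f, hr, h⟩ := exists_subfamily_bounded_coeff
    (fun i : Fin (N + 1) => AdjoinRoot.mk p (X ^ (i : ℕ) - C (ζ ^ (i : ℕ))))
  rw [(AdjoinRoot.powerBasis hp).finrank, AdjoinRoot.powerBasis_dim] at hr
  refine ⟨r, fun k => f k, hr, fun k => Nat.lt_succ_iff.1 (f k).2, fun i hi => ?_⟩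
  obtain ⟨c, hc, hci⟩ := h ⟨i, Nat.lt_succ_iff.2 hi⟩
  set s := ∑ k, c k • (X ^ (f k : ℕ) - C (ζ ^ (f k : ℕ))) with hs
  have hmk : AdjoinRoot.mk p (X ^ i - C (ζ ^ i)) = AdjoinRoot.mk p s := by
    rw [hs, map_sum]
    simp only [AdjoinRoot.smul_mk] at hci
    exact hci
  obtain ⟨a, ha⟩ := AdjoinRoot.mk_eq_mk.1 hmk
  have hdeg : ∀ j ≤ N, ((X : ℝ[X]) ^ j - C (ζ ^ j)).natDegree ≤ N := fun j hj =>
    (natDegree_sub_le _ _).trans (max_le ((natDegree_X_pow_le j).trans hj) (by simp))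
  refine ⟨c, a, hc, ?_, by rw [← hs, mul_comm a p, ← ha]; ring⟩
  by_cases ha0 : a = 0
  · exact Or.inl ha0
  · right
    rw [← natDegree_mul ha0 hp, mul_comm, ← ha]
    refine (natDegree_sub_le _ _).trans (max_le (hdeg i hi) ?_)
    refine natDegree_sum_le_of_forall_le _ _ fun k _ => ?_
    exact (natDegree_smul_le _ _).trans (hdeg _ (Nat.lt_succ_iff.1 (f k).2))

/-- Pigeonhole construction of simultaneous approximations to the powers of `ζ` from a polynomial
`P` with a small value at `ζ`. Among the points `(x, y_1, …, y_N)` with `0 ≤ x ≤ M` and `y_i` the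
integer nearest to `ζ ^ i * x`, two give the same values to the functional on multiples of `P`,
and nearly the same errors at a few well-chosen indices. The functional given by their difference
vanishes at the multiples of `P`, so that these few errors control all the others. -/
theorem exists_simultaneous_approximation {ζ η : ℝ} {n N M T B : ℕ} {P : ℤ[X]} (hP : P ≠ 0)
    (hPn : P.natDegree ≤ n) (hT : 1 ≤ T) (hη : M * |aeval ζ P| ≤ η)
    (hB : (N + 1) * (polyHeight P : ℝ) + absPowSum ζ N * η ≤ B)
    (hcount : (2 * B + 1) ^ (N + 1) * (2 * T + 1) ^ n < M + 1) :
    ∃ (x : ℤ) (y : ℕ → ℤ), 1 ≤ |(x : ℝ)| ∧ |(x : ℝ)| ≤ M ∧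
      ∀ i ≤ N, |ζ ^ i * x - y i| ≤ n / T := by
  have hT0 : (0 : ℝ) < T := by exact_mod_cast hT
  set p := P.map (Int.castRingHom ℝ) with hp
  have hp0 : p ≠ 0 := (Polynomial.map_ne_zero_iff (RingHom.injective_int _)).2 hP
  have hpdeg : p.natDegree = P.natDegree :=
    natDegree_map_eq_of_injective (RingHom.injective_int _) _
  obtain ⟨r, f, hr, hfN, hred⟩ := exists_bounded_reduction hp0 ζ N
  rw [hpdeg] at hr hred
  set z : ℕ → ℕ → ℤ := fun x i => round (ζ ^ i * x) with hz
  have herr : ∀ x i, |ζ ^ i * x - z x i| ≤ 1 / 2 := fun x i => abs_sub_round _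
  set g : ℕ → (Fin (N + 1) → ℤ) × (Fin r → ℤ) := fun x =>
    (fun j => if (j : ℕ) + P.natDegree ≤ N then
      ∑ i ∈ Finset.range (N + 1), z x i * (X ^ (j : ℕ) * P).coeff i else 0,
      fun k => ⌊T * (ζ ^ f k * x - z x (f k))⌋) with hg
  set t : Finset ((Fin (N + 1) → ℤ) × (Fin r → ℤ)) :=
    (Fintype.piFinset fun _ => Finset.Icc (-(B : ℤ)) B) ×ˢ
      (Fintype.piFinset fun _ => Finset.Icc (-(T : ℤ)) T) with ht
  have hcard : t.card < (Finset.range (M + 1)).card := by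
    rw [ht, Finset.card_product, Fintype.card_piFinset_const, Fintype.card_piFinset_const,
      Finset.card_range, Int.card_Icc, Int.card_Icc,
      show ((B : ℤ) + 1 - -(B : ℤ)).toNat = 2 * B + 1 by omega,
      show ((T : ℤ) + 1 - -(T : ℤ)).toNat = 2 * T + 1 by omega]
    refine lt_of_le_of_lt ?_ hcount
    gcongr
    · omega
    · exact hr.trans hPn
  have hmaps : Set.MapsTo g (Finset.range (M + 1)) t := by
    intro x hx
    have hxM : x ≤ M := by simpa [Nat.lt_succ_iff] using hx
    have hxM' : (x : ℝ) ≤ M := by exact_mod_cast hxM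
    rw [ht, Finset.mem_coe, Finset.mem_product, Fintype.mem_piFinset, Fintype.mem_piFinset]
    constructor
    · intro j
      simp only [hg]
      split_ifs with hj
      · have h1 := abs_momentMap_X_pow_mul_le (N := N) (y := fun i => (z x i : ℝ)) (x := x)
          (η := η) (P := P) (fun i _ => herr x i)
          (le_trans (by rw [Nat.abs_cast]; gcongr) hη) hj
        rw [momentMap_intCast] at h1
        have h2 : (N + 1) * ((polyHeight P : ℝ) * (1 / 2)) ≤ (N + 1) * (polyHeight P : ℝ) := by
          have : (0 : ℝ) ≤ polyHeight P := Nat.cast_nonneg _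
          gcongr
          linarith
        rw [Finset.mem_Icc, ← abs_le]
        have h3 := h1.trans ((add_le_add_left h2 _).trans hB)
        exact_mod_cast h3
      · simp
    · intro k
      have h1 := abs_le.1 (herr x (f k))
      simp only [hg, Finset.mem_Icc]
      constructor
      · rw [Int.le_floor]
        push_cast
        nlinarith
      · have h2 : T * (ζ ^ f k * x - z x (f k)) ≤ T := by nlinarith
        exact_mod_cast (Int.floor_le _).trans h2
  obtain ⟨x₁, hx₁, x₂, hx₂, hne, heq⟩ := Finset.exists_ne_map_eq_of_card_lt_of_maps_to hcard hmaps
  have hx₁M : x₁ ≤ M := by simpa [Nat.lt_succ_iff] using hx₁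
  have hx₂M : x₂ ≤ M := by simpa [Nat.lt_succ_iff] using hx₂
  set x : ℤ := x₁ - x₂ with hx
  set y : ℕ → ℤ := fun i => z x₁ i - z x₂ i with hy
  have hy0 : y 0 = x := by simp [hy, hz, hx]
  have hzero : ∀ j, j + P.natDegree ≤ N → momentMap N (fun i => y i) (X ^ j * p) = 0 := by
    intro j hj
    have h1 := congrFun (congrArg Prod.fst heq) ⟨j, by omega⟩
    simp only [hg, hj, if_true] at h1
    rw [hp, show X ^ j * P.map (Int.castRingHom ℝ) = (X ^ j * P).map (Int.castRingHom ℝ) by simp,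
      momentMap_intCast]
    simp only [hy, sub_mul, Finset.sum_sub_distrib, h1, sub_self, Int.cast_zero]
  have hfew : ∀ k, |ζ ^ f k * x - y (f k)| ≤ 1 / T := by
    intro k
    have h1 := congrFun (congrArg Prod.snd heq) k
    simp only [hg] at h1
    have h2 := Int.abs_sub_lt_one_of_floor_eq_floor h1
    rw [← mul_sub, abs_mul, abs_of_pos hT0] at h2
    rw [le_div_iff₀' hT0]
    refine le_of_eq_of_le ?_ h2.le
    congr 2
    simp only [hx, hy]
    push_cast
    ring
  have hmom : ∀ i ≤ N, momentMap N (fun i => y i) (X ^ i - C (ζ ^ i)) = -(ζ ^ i * x - y i) := by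
    intro i hi
    have h0 := momentMap_X_pow (Nat.zero_le N) (fun i => (y i : ℝ))
    rw [pow_zero] at h0
    rw [map_sub, momentMap_X_pow hi, ← mul_one (C (ζ ^ i)), C_mul', map_smul, h0, hy0, smul_eq_mul]
    ring
  refine ⟨x, y, ?_, ?_, fun i hi => ?_⟩
  · have : 1 ≤ |x| := Int.one_le_abs (by omega)
    exact_mod_cast this
  · have : |x| ≤ M := by rw [abs_le]; omega
    exact_mod_cast this
  · obtain ⟨c, a, hc, ha, hi'⟩ := hred i hi
    have hap : momentMap N (fun i => y i) (a * p) = 0 := by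
      rcases ha with rfl | ha
      · rw [zero_mul, map_zero]
      · exact momentMap_mul_eq_zero hzero ha
    have h1 := hmom i hi
    rw [hi', map_add, hap, add_zero, map_sum] at h1
    rw [← abs_neg, ← h1]
    calc _ ≤ ∑ k, |momentMap N (fun i => (y i : ℝ)) (c k • (X ^ f k - C (ζ ^ f k)))| :=
          Finset.abs_sum_le_sum_abs _ _
      _ ≤ ∑ k : Fin r, 1 / (T : ℝ) := by
          refine Finset.sum_le_sum fun k _ => ?_
          rw [map_smul, hmom _ (hfN k), smul_eq_mul, abs_mul, abs_neg]
          calc |c k| * _ ≤ 1 * (1 / (T : ℝ)) := by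
                gcongr
                · exact hc k
                · exact hfew k
            _ = 1 / (T : ℝ) := one_mul _
      _ = r / T := by simp [div_eq_mul_inv]
      _ ≤ n / T := by
          have : (r : ℝ) ≤ n := by exact_mod_cast hr.trans hPn
          gcongr

theorem le_lamExp {ζ : ℝ} {n : ℕ} {w : ℝ}
    (h : ∀ l < w, ∃ᶠ X : ℝ in atTop, ∃ (x : ℤ) (y : ℕ → ℤ), 1 ≤ |(x : ℝ)| ∧ |(x : ℝ)| ≤ X ∧
      ∀ i ∈ Finset.Icc 1 n, |ζ ^ i * (x : ℝ) - (y i : ℝ)| ≤ X ^ (-l)) :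
    (w : EReal) ≤ lamExp n ζ := by
  refine EReal.ge_of_forall_gt_iff_ge.1 fun v hv => ?_
  exact le_sSup (Set.mem_image_of_mem _ (h v (EReal.coe_lt_coe_iff.1 hv)))

/-- If `w_n(ζ) > 2N`, then `λ_N(ζ) ≥ 1 / (3n)`. -/
theorem one_div_le_lamExp {ζ : ℝ} {n N : ℕ} (hn : 1 ≤ n) (hN : 4 ≤ N)
    (hw : ((2 * N : ℝ) : EReal) < wExp n ζ) : ((1 / (3 * n) : ℝ) : EReal) ≤ lamExp N ζ := by
  refine le_lamExp fun l hl => ?_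
  have hn0 : (0 : ℝ) < n := by exact_mod_cast hn
  have hN4 : (4 : ℝ) ≤ N := by exact_mod_cast hN
  set A := ⌈absPowSum ζ N⌉₊ with hA
  have hA1 : absPowSum ζ N ≤ A := Nat.le_ceil _
  set K : ℕ := N + 1 + A with hK
  set β : ℝ := 2 * N / (3 * n) with hβ
  have hβ0 : 0 < β := by positivity
  have hβn : β * n = 2 * N / 3 := by rw [hβ]; field_simp
  have hβl : -β < -(2 * N * l) := by
    have : 2 * N * l < 2 * N * (1 / (3 * n)) := by gcongr
    rw [hβ]
    have h2 : (2 * N * (1 / (3 * n)) : ℝ) = 2 * N / (3 * n) := by ring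
    linarith
  -- With `H = H(P)`, the construction is applied with `M = H ^ (2N)` and `T = ⌊H ^ β⌋`.
  have hev := (eventually_mul_rpow_le (show (N : ℝ) + 1 + 2 * N / 3 < 2 * N by linarith)
    ((3 * K) ^ (N + 1) * 3 ^ n)).and (eventually_mul_rpow_le hβl (2 * n))
  rw [frequently_atTop]
  intro X₀
  obtain ⟨H₀, hH₀⟩ := eventually_atTop.1 hev
  obtain ⟨P, hPn, hPH, hP0, hPv⟩ := exists_of_lt_wExp hw (max H₀ (max X₀ 1))
  set H := polyHeight P with hH
  obtain ⟨h1, h2⟩ := hH₀ H ((le_max_left _ _).trans hPH.le)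
  have hHX : X₀ ≤ H := ((le_max_left _ _).trans (le_max_right _ _)).trans hPH.le
  have hH1 : (1 : ℝ) ≤ H := one_le_polyHeight hP0
  have hH0 : (0 : ℝ) < H := by linarith
  set T := ⌊(H : ℝ) ^ β⌋₊ with hT
  have hHβ : 1 ≤ (H : ℝ) ^ β := Real.one_le_rpow hH1 hβ0.le
  have hT1 : 1 ≤ T := Nat.le_floor (by simpa using hHβ)
  have hT1' : (1 : ℝ) ≤ T := by exact_mod_cast hT1
  have hTle : (T : ℝ) ≤ (H : ℝ) ^ β := Nat.floor_le (by positivity)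
  have hTlt : (H : ℝ) ^ β < T + 1 := Nat.lt_floor_add_one _
  have hpow : ((H ^ (2 * N) : ℕ) : ℝ) = (H : ℝ) ^ (2 * N : ℝ) := by
    rw [Nat.cast_pow, ← Real.rpow_natCast]; push_cast; rfl
  obtain ⟨x, y, hx1, hxM, hy⟩ := exists_simultaneous_approximation (ζ := ζ) (η := 1) (n := n)
    (N := N) (M := H ^ (2 * N)) (T := T) (B := K * H) hP0 hPn hT1 (by
      rw [hpow]
      calc (H : ℝ) ^ (2 * N : ℝ) * |aeval ζ P| ≤ (H : ℝ) ^ (2 * N : ℝ) * (H : ℝ) ^ (-(2 * N : ℝ)) := by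
            gcongr
        _ = 1 := by rw [← Real.rpow_add hH0, add_neg_cancel, Real.rpow_zero]) (by
      rw [← hH, hK]
      push_cast
      nlinarith) (by
      have hK1 : (1 : ℝ) ≤ K := by
        have : 1 ≤ K := by omega
        exact_mod_cast this
      have h3 : (((2 * (K * H) + 1) ^ (N + 1) * (2 * T + 1) ^ n : ℕ) : ℝ) ≤ (H ^ (2 * N) : ℕ) := by
        rw [hpow]
        push_cast
        calc (2 * ((K : ℝ) * H) + 1) ^ (N + 1) * (2 * (T : ℝ) + 1) ^ n
            ≤ (3 * K * H) ^ (N + 1) * (3 * (H : ℝ) ^ β) ^ n := by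
              gcongr
              · nlinarith
              · linarith
          _ = (3 * K) ^ (N + 1) * 3 ^ n * ((H : ℝ) ^ (N + 1) * ((H : ℝ) ^ β) ^ n) := by
              rw [mul_pow (3 * (K : ℝ)), mul_pow]; ring
          _ = (3 * K) ^ (N + 1) * 3 ^ n * (H : ℝ) ^ ((N : ℝ) + 1 + 2 * N / 3) := by
              rw [← hβn, Real.rpow_add hH0, Real.rpow_mul hH0.le, Real.rpow_natCast]
              congr 2
              exact_mod_cast (Real.rpow_natCast (H : ℝ) (N + 1)).symm
          _ ≤ _ := h1
      have h4 : (2 * (K * H) + 1) ^ (N + 1) * (2 * T + 1) ^ n ≤ H ^ (2 * N) := by exact_mod_cast h3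
      omega)
  refine ⟨(H : ℝ) ^ (2 * N : ℝ), ?_, x, y, hx1, hpow ▸ hxM, fun i hi => ?_⟩
  · refine hHX.trans ?_
    calc (H : ℝ) = (H : ℝ) ^ (1 : ℝ) := (Real.rpow_one _).symm
      _ ≤ _ := Real.rpow_le_rpow_of_exponent_le hH1 (by linarith)
  · refine (hy i (Finset.mem_Icc.1 hi).2).trans ?_
    calc (n : ℝ) / T ≤ n / ((H : ℝ) ^ β / 2) := by
          gcongr
          linarith
      _ = 2 * n * (H : ℝ) ^ (-β) := by rw [Real.rpow_neg hH0.le]; field_simp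
      _ ≤ _ := h2
      _ = _ := by rw [← Real.rpow_mul hH0.le]; ring_nf

/-! ### The resultant inequality -/

theorem sylvester_castAdd {f g : ℝ[X]} {m n : ℕ} (hg : g.natDegree ≤ n) (i : Fin (m + n))
    (j : Fin m) : sylvester f g m n i (Fin.castAdd n j) = (g * X ^ (j : ℕ)).coeff i := by
  simp only [sylvester, Matrix.of_apply, Fin.addCases_left, Set.mem_Icc, coeff_mul_X_pow']
  by_cases h1 : (j : ℕ) ≤ i
  · by_cases h2 : (i : ℕ) ≤ j + n
    · rw [if_pos ⟨h1, h2⟩, if_pos h1]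
    · rw [if_neg (by omega), if_pos h1, coeff_eq_zero_of_natDegree_lt (by omega)]
  · rw [if_neg (by omega), if_neg h1]

theorem sylvester_natAdd {f g : ℝ[X]} {m n : ℕ} (hf : f.natDegree ≤ m) (i : Fin (m + n))
    (j : Fin n) : sylvester f g m n i (Fin.natAdd m j) = (f * X ^ (j : ℕ)).coeff i := by
  simp only [sylvester, Matrix.of_apply, Fin.addCases_right, Set.mem_Icc, coeff_mul_X_pow']
  by_cases h1 : (j : ℕ) ≤ i
  · by_cases h2 : (i : ℕ) ≤ j + m
    · rw [if_pos ⟨h1, h2⟩, if_pos h1]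
    · rw [if_neg (by omega), if_pos h1, coeff_eq_zero_of_natDegree_lt (by omega)]
  · rw [if_neg (by omega), if_neg h1]

theorem abs_coeff_mul_X_pow_le {f : ℝ[X]} {B : ℝ} (hf : ∀ i, |f.coeff i| ≤ B) (j i : ℕ) :
    |(f * X ^ j).coeff i| ≤ B := by
  rw [coeff_mul_X_pow']
  split_ifs
  · exact hf _
  · rw [abs_zero]; exact (abs_nonneg _).trans (hf 0)

/-- The resultant of two polynomials with coefficients in `[-1, 1]` is bounded by their values at
`ζ`: the row vector `(1, ζ, ζ², …)` times the Sylvester matrix has the multiples of these values by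
powers of `ζ` as entries. -/
theorem abs_resultant_le {f g : ℝ[X]} {m n M : ℕ} (hmn : 0 < m + n) (hM : m + n ≤ M)
    (hf : f.natDegree ≤ m) (hg : g.natDegree ≤ n) (hf1 : ∀ i, |f.coeff i| ≤ 1)
    (hg1 : ∀ i, |g.coeff i| ≤ 1) (ζ : ℝ) :
    |f.resultant g m n| ≤
      M * (absPowSum ζ M * (|f.eval ζ| + |g.eval ζ|) * (M.factorial : ℝ)) := by
  set S := sylvester f g m n with hS
  have hA := one_le_absPowSum ζ M
  have hS1 : ∀ i j, |S i j| ≤ 1 := by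
    intro i j
    refine Fin.addCases (fun j => ?_) (fun j => ?_) j
    · rw [hS, sylvester_castAdd hg]; exact abs_coeff_mul_X_pow_le hg1 _ _
    · rw [hS, sylvester_natAdd hf]; exact abs_coeff_mul_X_pow_le hf1 _ _
  set u : Fin (m + n) → ℝ := fun i => ζ ^ (i : ℕ) with hu
  have heval : ∀ (h : ℝ[X]) (k j : ℕ), h.natDegree ≤ k → k + j < m + n →
      ∑ i : Fin (m + n), ζ ^ (i : ℕ) * (h * X ^ j).coeff i = ζ ^ j * h.eval ζ := by
    intro h k j hk hkj
    have h1 : (h * X ^ j).natDegree < m + n :=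
      natDegree_mul_le.trans_lt ((add_le_add hk (natDegree_X_pow_le j)).trans_lt hkj)
    have h2 := eval_eq_sum_range' h1 ζ
    rw [Finset.sum_range, eval_mul, eval_pow, eval_X] at h2
    rw [mul_comm (ζ ^ j), h2]
    exact Finset.sum_congr rfl fun i _ => mul_comm _ _
  have huS : ∀ j, |(Matrix.vecMul u S) j| ≤ absPowSum ζ M * (|f.eval ζ| + |g.eval ζ|) := by
    intro j
    have hle : ∀ (k : ℕ) (h : ℝ[X]), k ≤ M → |h.eval ζ| ≤ |f.eval ζ| + |g.eval ζ| →
        |ζ ^ k * h.eval ζ| ≤ absPowSum ζ M * (|f.eval ζ| + |g.eval ζ|) := by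
      intro k h hk hh
      rw [abs_mul, abs_pow]
      exact mul_le_mul (abs_pow_le_absPowSum ζ hk) hh (abs_nonneg _) (by linarith)
    refine Fin.addCases (fun j => ?_) (fun j => ?_) j
    · have h1 : Matrix.vecMul u S (Fin.castAdd n j) = ζ ^ (j : ℕ) * g.eval ζ := by
        simp only [Matrix.vecMul, dotProduct, hu, hS, sylvester_castAdd hg]
        exact heval g n j hg (by omega)
      rw [h1]
      exact hle j g (by omega) (by linarith [abs_nonneg (f.eval ζ)])
    · have h1 : Matrix.vecMul u S (Fin.natAdd m j) = ζ ^ (j : ℕ) * f.eval ζ := by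
        simp only [Matrix.vecMul, dotProduct, hu, hS, sylvester_natAdd hf]
        exact heval f m j hf (by omega)
      rw [h1]
      exact hle j f (by omega) (by linarith [abs_nonneg (g.eval ζ)])
  have hfact : (((m + n).factorial : ℕ) : ℝ) ≤ (M.factorial : ℝ) := by
    exact_mod_cast Nat.factorial_le hM
  have hadj : ∀ i j, |S.adjugate i j| ≤ (M.factorial : ℝ) := by
    intro i j
    rw [Matrix.adjugate_apply]
    have h1 := Matrix.det_le (A := S.updateRow j (Pi.single i 1)) (abv := AbsoluteValue.abs)
      (x := 1) (by
        intro k l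
        rw [Matrix.updateRow_apply]
        split_ifs
        · rw [Pi.single_apply]
          split_ifs <;> simp
        · exact hS1 k l)
    simp only [one_pow, nsmul_eq_mul, mul_one, Fintype.card_fin] at h1
    exact h1.trans hfact
  have hdet : f.resultant g m n = ∑ j, Matrix.vecMul u S j * S.adjugate j ⟨0, hmn⟩ := by
    have h1 : Matrix.vecMul (Matrix.vecMul u S) S.adjugate = S.det • u := by
      rw [Matrix.vecMul_vecMul, Matrix.mul_adjugate, Matrix.vecMul_smul, Matrix.vecMul_one]
    have h2 := congrFun h1 ⟨0, hmn⟩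
    simp only [Pi.smul_apply, hu, pow_zero, smul_eq_mul, mul_one] at h2
    rw [resultant, ← hS, ← h2]
    rfl
  rw [hdet]
  calc _ ≤ ∑ j, |Matrix.vecMul u S j * S.adjugate j ⟨0, hmn⟩| := Finset.abs_sum_le_sum_abs _ _
    _ ≤ ∑ _j : Fin (m + n),
        absPowSum ζ M * (|f.eval ζ| + |g.eval ζ|) * (M.factorial : ℝ) := by
        refine Finset.sum_le_sum fun j _ => ?_
        rw [abs_mul]
        exact mul_le_mul (huS j) (hadj _ _) (abs_nonneg _) (by positivity)
    _ = ((m + n : ℕ) : ℝ) * (absPowSum ζ M * (|f.eval ζ| + |g.eval ζ|) * (M.factorial : ℝ)) := by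
        simp
    _ ≤ _ := by
        have : ((m + n : ℕ) : ℝ) ≤ M := by exact_mod_cast hM
        gcongr

/-- Two coprime integer polynomials cannot both have very small values at `ζ`. -/
theorem exists_resultant_bound (ζ : ℝ) (n N : ℕ) :
    ∃ C : ℝ, 1 ≤ C ∧ ∀ P Q : ℤ[X], P ≠ 0 → Q ≠ 0 → Q.natDegree ≠ 0 →
      IsCoprime (P.map (Int.castRingHom ℝ)) (Q.map (Int.castRingHom ℝ)) →
      P.natDegree ≤ n → Q.natDegree ≤ N →
      1 ≤ C * ((polyHeight P : ℝ) ^ N * (polyHeight Q : ℝ) ^ n * (|aeval ζ P| + |aeval ζ Q|)) := by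
  have hA := one_le_absPowSum ζ (n + N)
  refine ⟨1 + (n + N : ℕ) * (absPowSum ζ (n + N) * ((n + N).factorial : ℝ)),
    le_add_of_nonneg_right (by positivity),
    fun P Q hP hQ hQ0 hcop hPn hQN => ?_⟩
  have hPH := one_le_polyHeight hP
  have hQH := one_le_polyHeight hQ
  have hPH0 : (0 : ℝ) < polyHeight P := by linarith
  have hQH0 : (0 : ℝ) < polyHeight Q := by linarith
  set p := P.map (Int.castRingHom ℝ) with hp
  set q := Q.map (Int.castRingHom ℝ) with hq
  have hpdeg : p.natDegree = P.natDegree :=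
    natDegree_map_eq_of_injective (RingHom.injective_int _) _
  have hqdeg : q.natDegree = Q.natDegree :=
    natDegree_map_eq_of_injective (RingHom.injective_int _) _
  -- The resultant is a nonzero integer. (`map` preserves it since the sizes are kept.)
  have hres1 : 1 ≤ |p.resultant q P.natDegree Q.natDegree| := by
    have h0 : p.resultant q P.natDegree Q.natDegree ≠ 0 := by
      rw [← hpdeg, ← hqdeg]; exact resultant_ne_zero p q hcop
    rw [hp, hq, resultant_map_map] at h0 ⊢
    have h1 : P.resultant Q ≠ 0 := by
      intro h
      rw [h, map_zero] at h0
      exact h0 rfl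
    have h2 : (1 : ℤ) ≤ |P.resultant Q| := Int.one_le_abs h1
    rw [eq_intCast]
    exact_mod_cast h2
  set f := C ((polyHeight P : ℝ)⁻¹) * p with hf
  set g := C ((polyHeight Q : ℝ)⁻¹) * q with hg
  have hpf : p = C (polyHeight P : ℝ) * f := by
    rw [hf, ← mul_assoc, ← C_mul, mul_inv_cancel₀ hPH0.ne', C_1, one_mul]
  have hqg : q = C (polyHeight Q : ℝ) * g := by
    rw [hg, ← mul_assoc, ← C_mul, mul_inv_cancel₀ hQH0.ne', C_1, one_mul]
  have hf1 : ∀ i, |f.coeff i| ≤ 1 := by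
    intro i
    rw [hf, coeff_C_mul, abs_mul, abs_of_pos (by positivity : 0 < (polyHeight P : ℝ)⁻¹),
      inv_mul_le_iff₀ hPH0, mul_one, hp, coeff_map]
    exact abs_coeff_le_polyHeight P i
  have hg1 : ∀ i, |g.coeff i| ≤ 1 := by
    intro i
    rw [hg, coeff_C_mul, abs_mul, abs_of_pos (by positivity : 0 < (polyHeight Q : ℝ)⁻¹),
      inv_mul_le_iff₀ hQH0, mul_one, hq, coeff_map]
    exact abs_coeff_le_polyHeight Q i
  have hfv : |f.eval ζ| ≤ |aeval ζ P| := by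
    rw [hf, eval_C_mul, abs_mul, abs_of_pos (by positivity : 0 < (polyHeight P : ℝ)⁻¹), hp,
      ← aeval_eq_eval_map]
    exact mul_le_of_le_one_left (abs_nonneg _) (inv_le_one_of_one_le₀ hPH)
  have hgv : |g.eval ζ| ≤ |aeval ζ Q| := by
    rw [hg, eval_C_mul, abs_mul, abs_of_pos (by positivity : 0 < (polyHeight Q : ℝ)⁻¹), hq,
      ← aeval_eq_eval_map]
    exact mul_le_of_le_one_left (abs_nonneg _) (inv_le_one_of_one_le₀ hQH)
  have hbound := abs_resultant_le (f := f) (g := g) (m := P.natDegree) (n := Q.natDegree)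
    (M := n + N) (by omega) (by omega) ((natDegree_C_mul_le _ _).trans hpdeg.le)
    ((natDegree_C_mul_le _ _).trans hqdeg.le) hf1 hg1 ζ
  have hscale : p.resultant q P.natDegree Q.natDegree =
      (polyHeight P : ℝ) ^ Q.natDegree * ((polyHeight Q : ℝ) ^ P.natDegree *
        f.resultant g P.natDegree Q.natDegree) := by
    conv_lhs => rw [hpf, hqg]
    rw [resultant_C_mul_left, resultant_C_mul_right]
  rw [hscale, abs_mul, abs_mul, abs_of_pos (by positivity : (0 : ℝ) < (polyHeight P : ℝ) ^ Q.natDegree),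
    abs_of_pos (by positivity : (0 : ℝ) < (polyHeight Q : ℝ) ^ P.natDegree)] at hres1
  set V := |aeval ζ P| + |aeval ζ Q| with hV
  have hV0 : 0 ≤ V := by positivity
  have hfg : |f.eval ζ| + |g.eval ζ| ≤ V := add_le_add hfv hgv
  calc (1 : ℝ) ≤ _ := hres1
    _ ≤ (polyHeight P : ℝ) ^ N * ((polyHeight Q : ℝ) ^ n *
        ((n + N : ℕ) * (absPowSum ζ (n + N) * V * ((n + N).factorial : ℝ)))) := by
        gcongr
        refine hbound.trans ?_
        gcongr
    _ = ((n + N : ℕ) * (absPowSum ζ (n + N) * ((n + N).factorial : ℝ))) *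
        ((polyHeight P : ℝ) ^ N * (polyHeight Q : ℝ) ^ n * V) := by ring
    _ ≤ _ := by
        gcongr
        linarith

/-! ### Upper bounds for `ŵ*_n` -/

/-- If `w_n(ζ) > w > N`, then `ŵ*_N(ζ) ≤ n (w + 1) / (w - N)`. For a polynomial `P` with a very small
value at `ζ`, and for a suitable `X`, an approximation `α` to `ζ` with `H(α) ≤ X` is not very good,
by the resultant inequality if `α` is not a root of `P`, and trivially otherwise. -/
theorem wHatStarExp_le {ζ : ℝ} (hζ : Transcendental ℚ ζ) {n N : ℕ} (hn : 1 ≤ n) {w : ℝ} (hNw : N < w)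
    (hw : (w : EReal) < wExp n ζ) : wHatStarExp N ζ ≤ ((n * (w + 1) / (w - N) : ℝ) : EReal) := by
  refine sSup_le ?_
  rintro _ ⟨s, hs, rfl⟩
  refine EReal.coe_le_coe_iff.2 (not_lt.1 fun hlt => ?_)
  have hn0 : (0 : ℝ) < n := by exact_mod_cast hn
  have hN0 : (0 : ℝ) ≤ N := Nat.cast_nonneg N
  have hwN : 0 < w - N := by linarith
  have hlt' : n * (w + 1) < s * (w - N) := by rwa [div_lt_iff₀ hwN] at hlt
  have hsn : n < s := by
    refine lt_of_le_of_lt ?_ hlt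
    rw [le_div_iff₀ hwN]
    gcongr
    linarith
  have hs0 : 0 < s := by linarith
  obtain ⟨C, hC1, hC⟩ := exists_resultant_bound ζ n N
  set L₁ : ℝ := (N + 1) * (N * (|ζ| + 1) ^ N) with hL₁
  set L₂ : ℝ := (n + 1) * (n * (|ζ| + 1) ^ n) with hL₂
  have hL₁0 : 0 ≤ L₁ := by positivity
  have hL₂0 : 0 ≤ L₂ := by positivity
  set L : ℝ := L₁ + L₂ + 1 with hL
  obtain ⟨X₀, hX₀⟩ := eventually_atTop.1 (hs : ∀ᶠ X : ℝ in atTop, _)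
  set t : ℝ := 1 / n with ht
  have ht0 : 0 < t := by positivity
  have hst : 1 < s * t := by rw [ht, mul_one_div, one_lt_div hn0]; exact hsn
  have hexp : 1 + N * (s * t) < w * (s * t - 1) := by
    have : s * t * n = s := by rw [ht]; field_simp
    nlinarith
  -- `H` has to be so large that `X ≥ max X₀ 1`, and that the final inequality fails.
  have hev := (eventually_mul_rpow_le (show (0 : ℝ) < (w - N) * t by positivity)
    (max X₀ 1 * (4 * C) ^ t)).and
    (eventually_mul_rpow_le hexp (2 * (L * (4 * C) ^ (s * t))))
  obtain ⟨H₀, hH₀⟩ := eventually_atTop.1 hev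
  obtain ⟨P, hPn, hPH, hP0, hPv⟩ := exists_of_lt_wExp hw H₀
  set H : ℝ := (polyHeight P : ℝ) with hH
  have hH1 : 1 ≤ H := one_le_polyHeight hP0
  have hH0 : 0 < H := by linarith
  obtain ⟨hX, hfinal⟩ := hH₀ H hPH.le
  set v := |aeval ζ P| with hv
  have hv0 : 0 < v := abs_pos.2 (aeval_ne_zero_of_transcendental hζ hP0)
  set U : ℝ := 4 * C * (H ^ N * v) with hU
  have hU0 : 0 < U := by positivity
  have hUle : U ≤ 4 * C * H ^ (-(w - N)) := by
    rw [hU]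
    gcongr
    calc H ^ N * v ≤ H ^ N * H ^ (-w) := by gcongr
      _ = H ^ (-(w - N)) := by
        rw [← Real.rpow_natCast, ← Real.rpow_add hH0]; ring_nf
  -- `X` is such that the term with `|P(ζ)|` in the resultant inequality is at most `1 / 4`.
  set X : ℝ := U ^ (-t) with hXdef
  have hX0 : 0 < X := by positivity
  have hXbig : max X₀ 1 ≤ X := by
    have h1 : (4 * C * H ^ (-(w - N))) ^ (-t) ≤ X :=
      Real.rpow_le_rpow_of_nonpos hU0 hUle (by linarith)
    refine le_trans ?_ h1
    rw [Real.mul_rpow (by positivity) (by positivity), ← Real.rpow_mul hH0.le, neg_mul_neg,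
      Real.rpow_neg (by positivity), inv_mul_eq_div, le_div_iff₀ (by positivity)]
    simpa using hX
  have hX1 : 1 ≤ X := (le_max_right _ _).trans hXbig
  have hXn : X ^ n = U⁻¹ := by
    rw [hXdef, ← Real.rpow_natCast, ← Real.rpow_mul hU0.le, ht, neg_mul,
      one_div_mul_cancel hn0.ne', Real.rpow_neg_one]
  have hXs : X ^ (-s) = U ^ (s * t) := by
    rw [hXdef, ← Real.rpow_mul hU0.le]
    ring_nf
  obtain ⟨α, Q, hQ, hQN, hQX, hQα⟩ := hX₀ X ((le_max_left _ _).trans hXbig)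
  have hQ1 := one_le_polyHeight hQ.1.ne_zero
  have hXs0 : 0 < X ^ (-s) := by positivity
  have hα : |ζ - α| ≤ X ^ (-s) :=
    hQα.trans (mul_le_of_le_one_left hXs0.le (inv_le_one_of_one_le₀ hQ1))
  have hα1 : |ζ - α| ≤ 1 :=
    hα.trans (Real.rpow_le_one_of_one_le_of_nonpos hX1 (by linarith))
  have hkey : v ≤ L * (H * X ^ (-s)) := by
    by_cases hdvd : Q ∣ P
    · have hroot : aeval α P = 0 := by
        obtain ⟨E, rfl⟩ := hdvd
        rw [map_mul, hQ.2, zero_mul]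
      have h1 := abs_aeval_sub_aeval_le hPn hα1
      rw [hroot, sub_zero] at h1
      calc v ≤ L₂ * H * |ζ - α| := h1
        _ ≤ L * H * X ^ (-s) := by
          gcongr
          linarith
        _ = _ := by ring
    · have hcop := (isCoprime_map_of_irreducible hQ.1 hQ.natDegree_ne_zero hdvd).symm
      have h1 := hC P Q hP0 hQ.1.ne_zero hQ.natDegree_ne_zero hcop hPn hQN
      have h2 : |aeval ζ Q| ≤ L₁ * X ^ (-s) := by
        have h3 := abs_aeval_sub_aeval_le hQN hα1
        rw [hQ.2, sub_zero] at h3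
        calc |aeval ζ Q| ≤ L₁ * polyHeight Q * |ζ - α| := h3
          _ ≤ L₁ * polyHeight Q * ((polyHeight Q : ℝ)⁻¹ * X ^ (-s)) := by gcongr
          _ = L₁ * X ^ (-s) := by field_simp
      have h4 : 1 ≤ C * (H ^ N * X ^ n * (v + L₁ * X ^ (-s))) := by
        refine h1.trans ?_
        gcongr
      have h5 : C * (H ^ N * X ^ n * (v + L₁ * X ^ (-s))) = (v + L₁ * X ^ (-s)) / (4 * v) := by
        rw [hXn, hU]
        field_simp
      rw [h5, one_le_div (by positivity)] at h4
      calc v ≤ L₁ * X ^ (-s) := by linarith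
        _ ≤ L₁ * (H * X ^ (-s)) := by
          gcongr
          exact le_mul_of_one_le_left hXs0.le hH1
        _ ≤ _ := by
          gcongr
          linarith
  have hUs : U ^ (s * t) = (4 * C) ^ (s * t) * (H ^ (N * (s * t)) * v ^ (s * t)) := by
    rw [hU, Real.mul_rpow (by positivity) (by positivity),
      Real.mul_rpow (by positivity) hv0.le, ← Real.rpow_natCast, ← Real.rpow_mul hH0.le]
  have hvs : v ^ (s * t) = v * v ^ (s * t - 1) := by
    rw [Real.rpow_sub_one hv0.ne']
    field_simp
  have hvw : v ^ (s * t - 1) ≤ H ^ (-(w * (s * t - 1))) := by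
    calc v ^ (s * t - 1) ≤ (H ^ (-w)) ^ (s * t - 1) :=
          Real.rpow_le_rpow hv0.le hPv (by linarith)
      _ = _ := by rw [← Real.rpow_mul hH0.le, neg_mul]
  set K : ℝ := L * (4 * C) ^ (s * t) with hK
  have hK0 : 0 < K := by positivity
  have h1 : v * 1 ≤ v * (K * H ^ (1 + N * (s * t)) * H ^ (-(w * (s * t - 1)))) := by
    calc v * 1 ≤ L * (H * X ^ (-s)) := by rw [mul_one]; exact hkey
      _ = v * (K * H ^ (1 + N * (s * t)) * v ^ (s * t - 1)) := by
        rw [hXs, hUs, hvs, Real.rpow_add hH0, Real.rpow_one, hK]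
        ring
      _ ≤ _ := by gcongr
  have h2 := le_of_mul_le_mul_left h1 hv0
  rw [Real.rpow_neg hH0.le, ← div_eq_mul_inv, one_le_div (by positivity)] at h2
  have h3 : 0 < K * H ^ (1 + N * (s * t)) := by positivity
  linarith

/-- The minimal polynomial of a good approximation `α` has a small value at `ζ`. -/
theorem wHatStarExp_le_wExp {ζ : ℝ} (hζ : Transcendental ℚ ζ) {n : ℕ} (hn : 1 ≤ n) :
    wHatStarExp n ζ ≤ wExp n ζ := by
  have hw0 : 0 ≤ wExp n ζ := le_trans (by simp) (natCast_le_wExp hζ hn)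
  refine sSup_le ?_
  rintro _ ⟨s, hs, rfl⟩
  refine EReal.ge_of_forall_gt_iff_ge.1 fun v hv => ?_
  have hvs : v < s := EReal.coe_lt_coe_iff.1 hv
  rcases le_or_gt v 0 with hv0 | hv0
  · exact le_trans (by exact_mod_cast hv0) hw0
  have hs0 : 0 < s := by linarith
  set L : ℝ := (n + 1) * (n * (|ζ| + 1) ^ n) with hL
  refine le_wExp_of_forall_exists fun ε hε => ?_
  have hlim : Tendsto (fun X : ℝ => L * X ^ (-s)) atTop (nhds 0) := by
    simpa using (tendsto_rpow_neg_atTop hs0).const_mul L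
  obtain ⟨X, ⟨⟨⟨α, P, hP, hPn, hPX, hPα⟩, hXε⟩, hXv⟩, hX1⟩ :=
    (((show ∀ᶠ X : ℝ in atTop, _ from hs).and (hlim.eventually_lt_const hε)).and
      (eventually_mul_rpow_le (neg_lt_neg hvs) L)).and (eventually_ge_atTop 1) |>.exists
  have hP1 := one_le_polyHeight hP.1.ne_zero
  have hα1 : |ζ - α| ≤ 1 := hPα.trans (mul_le_one₀ (inv_le_one_of_one_le₀ hP1) (by positivity)
    (Real.rpow_le_one_of_one_le_of_nonpos hX1 (by linarith)))
  have h1 : |aeval ζ P| ≤ L * X ^ (-s) := by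
    have h2 := abs_aeval_sub_aeval_le hPn hα1
    rw [hP.2, sub_zero] at h2
    calc |aeval ζ P| ≤ L * polyHeight P * |ζ - α| := h2
      _ ≤ L * polyHeight P * ((polyHeight P : ℝ)⁻¹ * X ^ (-s)) := by gcongr
      _ = L * X ^ (-s) := by field_simp
  exact ⟨P, hPn, abs_pos.2 (aeval_ne_zero_of_transcendental hζ hP.1.ne_zero), h1.trans_lt hXε,
    h1.trans (hXv.trans (Real.rpow_le_rpow_of_nonpos (by linarith) hPX (by linarith)))⟩

/-! ### Comparison of the upper and lower limits -/

theorem lt_div_of_coe_lt_div {S : EReal} (hS : 0 < S) {k a : ℝ} (ha : 0 < a)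
    (h : (a : EReal) < k / S) : S < ((k / a : ℝ) : EReal) := by
  induction S with
  | bot => exact absurd hS (by simp)
  | coe r =>
    have hr : 0 < r := by exact_mod_cast hS
    rw [← EReal.coe_div, EReal.coe_lt_coe_iff, lt_div_iff₀ hr] at h
    rw [EReal.coe_lt_coe_iff, lt_div_iff₀ ha]
    linarith
  | top =>
    rw [EReal.div_top] at h
    exact absurd h (not_lt.2 (by exact_mod_cast ha.le))

theorem coe_div_lt_of_div_lt {S : EReal} (hS : 0 < S) {k a : ℝ} (ha : 0 < a)
    (h : k / S < (a : EReal)) : ((k / a : ℝ) : EReal) < S := by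
  induction S with
  | bot => exact absurd hS (by simp)
  | coe r =>
    have hr : 0 < r := by exact_mod_cast hS
    rw [← EReal.coe_div, EReal.coe_lt_coe_iff, div_lt_iff₀ hr] at h
    rw [EReal.coe_lt_coe_iff, div_lt_iff₀ ha]
    linarith
  | top => exact EReal.coe_lt_top _

theorem lt_coe_mul_of_div_lt {u : EReal} {n : ℕ} (hn : 1 ≤ n) {c : ℝ}
    (h : u / (n : EReal) < c) : u < ((c * n : ℝ) : EReal) := by
  rw [EReal.div_lt_iff (by exact_mod_cast hn) (EReal.natCast_ne_top n)] at h
  push_cast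
  exact h

theorem coe_mul_lt_of_lt_div {u : EReal} {n : ℕ} (hn : 1 ≤ n) {c : ℝ}
    (h : c < u / (n : EReal)) : ((c * n : ℝ) : EReal) < u := by
  rw [EReal.lt_div_iff (by exact_mod_cast hn) (EReal.natCast_ne_top n)] at h
  push_cast
  exact h

theorem coe_le_div_of_mul_le {u : EReal} {n : ℕ} (hn : 1 ≤ n) {c : ℝ}
    (h : ((c * n : ℝ) : EReal) ≤ u) : (c : EReal) ≤ u / (n : EReal) := by
  rw [EReal.le_div_iff_mul_le (by exact_mod_cast hn) (EReal.natCast_ne_top n)]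
  push_cast at h
  exact h

theorem div_le_coe_of_le_mul {u : EReal} {n : ℕ} (hn : 1 ≤ n) {c : ℝ}
    (h : u ≤ ((c * n : ℝ) : EReal)) : u / (n : EReal) ≤ c := by
  rw [EReal.div_le_iff_le_mul (by exact_mod_cast hn) (EReal.natCast_ne_top n), mul_comm]
  push_cast at h
  exact h

theorem natCast_le_wHatStarExp_of_add_le {ζ : ℝ} (hζ : Transcendental ℚ ζ) {n N : ℕ} (hn : 1 ≤ n)
    {w : ℝ} (hw0 : 0 ≤ w) (hw : wExp n ζ < w) (hN : w + 2 * n ≤ N) :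
    (n : EReal) ≤ wHatStarExp N ζ := by
  have hnN : n ≤ N := by
    have h1 : (n : ℝ) ≤ N := by linarith [(Nat.cast_nonneg n : (0 : ℝ) ≤ n)]
    exact_mod_cast h1
  have := natCast_le_wHatStarExp hζ hn (m := N - n) hw0 hw (by
    rw [Nat.cast_sub hnN]; linarith)
  rwa [Nat.add_sub_cancel' hnN] at this

theorem lamExp_le_of_add_le {ζ : ℝ} (hζ : Transcendental ℚ ζ) {n N : ℕ} (hn : 1 ≤ n)
    {w : ℝ} (hw0 : 0 ≤ w) (hw : wExp n ζ < w) (hN : w + 2 * n ≤ N) :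
    lamExp N ζ ≤ ((1 / n : ℝ) : EReal) := by
  have hnN : n ≤ N := by
    have h1 : (n : ℝ) ≤ N := by linarith [(Nat.cast_nonneg n : (0 : ℝ) ≤ n)]
    exact_mod_cast h1
  have := lamExp_le hζ hn (m := N - n) hw0 hw (by
    rw [Nat.cast_sub hnN]; linarith)
  rwa [Nat.add_sub_cancel' hnN] at this

theorem one_le_wInf {ζ : ℝ} (hζ : Transcendental ℚ ζ) : 1 ≤ wInf ζ := by
  refine le_liminf_of_le (by isBoundedDefault) ?_
  filter_upwards [eventually_ge_atTop 1] with n hn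
  rw [← EReal.coe_one]
  exact coe_le_div_of_mul_le hn (by simpa using natCast_le_wExp hζ hn)

theorem wInf_le_wSup (ζ : ℝ) : wInf ζ ≤ wSup ζ := liminf_le_limsup

theorem zero_le_wHatStarInf (ζ : ℝ) : 0 ≤ wHatStarInf ζ := by
  refine le_liminf_of_le (by isBoundedDefault) ?_
  filter_upwards [eventually_ge_atTop 1] with n hn
  exact EReal.div_nonneg (zero_le_one.trans (one_le_wHatStarExp ζ hn)) (by exact_mod_cast n.zero_le)

theorem wHatStarInf_le_wHatStarSup (ζ : ℝ) : wHatStarInf ζ ≤ wHatStarSup ζ := liminf_le_limsup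

theorem wHatStarExp_div_le_wExp_div {ζ : ℝ} (hζ : Transcendental ℚ ζ) :
    ∀ᶠ n : ℕ in atTop, wHatStarExp n ζ / (n : EReal) ≤ wExp n ζ / (n : EReal) := by
  filter_upwards [eventually_ge_atTop 1] with n hn
  exact EReal.div_le_div_right_of_nonneg (by exact_mod_cast n.zero_le) (wHatStarExp_le_wExp hζ hn)

theorem lt_sub_two_of_coe_lt {S : EReal} (hS : 0 < S) {a : ℝ} (ha : 0 < a)
    (h : (a : EReal) < 1 / (S + 2)) : S < ((1 / a - 2 : ℝ) : EReal) := by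
  have h1 := lt_div_of_coe_lt_div (S := S + 2) (k := 1)
    (lt_of_lt_of_le hS (le_add_of_nonneg_right (by norm_num))) ha (by simpa using h)
  induction S with
  | bot => exact absurd hS (by simp)
  | coe r =>
    have h2 : r + 2 < 1 / a := by
      rw [show (2 : EReal) = ((2 : ℝ) : EReal) from rfl, ← EReal.coe_add] at h1
      exact EReal.coe_lt_coe_iff.1 h1
    exact_mod_cast lt_sub_iff_add_lt.2 h2
  | top =>
    have : (⊤ : EReal) + 2 = ⊤ := rfl
    rw [this] at h1
    exact absurd h1 (not_lt.2 le_top)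

/-- If `w_n(ζ) < c n`, then `ŵ*_N(ζ) ≥ n` for `N ≥ (c + 2) n`. -/
theorem one_div_wSup_add_two_le {ζ : ℝ} (hζ : Transcendental ℚ ζ) :
    1 / (wSup ζ + 2) ≤ wHatStarInf ζ := by
  have hS1 : 1 ≤ wSup ζ := (one_le_wInf hζ).trans (wInf_le_wSup ζ)
  refine EReal.ge_of_forall_gt_iff_ge.1 fun x hx => ?_
  rcases le_or_gt x 0 with hx0 | hx0
  · exact le_trans (by exact_mod_cast hx0) (zero_le_wHatStarInf ζ)
  obtain ⟨x', hxx', hx'⟩ := EReal.lt_iff_exists_real_btwn.1 hx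
  have hxx : x < x' := by exact_mod_cast hxx'
  have hx'0 : 0 < x' := hx0.trans hxx
  set c := 1 / x' - 2 with hc
  have hcS : wSup ζ < c := lt_sub_two_of_coe_lt (zero_lt_one.trans_le hS1) hx'0 hx'
  have hc1 : 1 < c := by exact_mod_cast hS1.trans_lt hcS
  obtain ⟨n₀, hn₀⟩ := eventually_atTop.1 (eventually_lt_of_limsup_lt hcS)
  refine le_liminf_of_le (by isBoundedDefault) ?_
  have hlim : Tendsto (fun N : ℕ => x' * (N : ℝ)) atTop atTop :=
    tendsto_natCast_atTop_atTop.const_mul_atTop hx'0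
  have hlim2 : Tendsto (fun N : ℕ => (x' - x) * (N : ℝ)) atTop atTop :=
    tendsto_natCast_atTop_atTop.const_mul_atTop (sub_pos.2 hxx)
  filter_upwards [hlim.eventually_ge_atTop ((n₀ + 1 : ℕ) : ℝ), hlim2.eventually_ge_atTop 1,
    eventually_ge_atTop 1] with N hN1 hN2 hN
  set n := ⌊x' * (N : ℝ)⌋₊ with hn
  have hnn : n₀ + 1 ≤ n := Nat.le_floor hN1
  have hn1 : 1 ≤ n := by omega
  have hnle : (n : ℝ) ≤ x' * N := Nat.floor_le (by positivity)
  have hnlt : x' * N < n + 1 := Nat.lt_floor_add_one _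
  have hw := lt_coe_mul_of_div_lt hn1 (hn₀ n (by omega))
  refine coe_le_div_of_mul_le hN (le_trans ?_
    (natCast_le_wHatStarExp_of_add_le hζ hn1 (by positivity) hw ?_))
  · have : x * N ≤ (n : ℝ) := by linarith
    exact_mod_cast this
  · have h1 : c * n + 2 * n = n / x' := by rw [hc]; field_simp; ring
    rw [h1, div_le_iff₀ hx'0]
    linarith

theorem one_div_wInf_add_two_le {ζ : ℝ} (hζ : Transcendental ℚ ζ) :
    1 / (wInf ζ + 2) ≤ wHatStarSup ζ := by
  have hS1 : 1 ≤ wInf ζ := one_le_wInf hζ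
  refine EReal.ge_of_forall_gt_iff_ge.1 fun x hx => ?_
  rcases le_or_gt x 0 with hx0 | hx0
  · exact le_trans (by exact_mod_cast hx0)
      ((zero_le_wHatStarInf ζ).trans (wHatStarInf_le_wHatStarSup ζ))
  obtain ⟨x', hxx', hx'⟩ := EReal.lt_iff_exists_real_btwn.1 hx
  have hxx : x < x' := by exact_mod_cast hxx'
  have hx'0 : 0 < x' := hx0.trans hxx
  set c := 1 / x' - 2 with hc
  have hcS : wInf ζ < c := lt_sub_two_of_coe_lt (zero_lt_one.trans_le hS1) hx'0 hx'
  have hc1 : 1 < c := by exact_mod_cast hS1.trans_lt hcS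
  have hfreq : ∃ᶠ n : ℕ in atTop, wExp n ζ / (n : EReal) < c :=
    frequently_lt_of_liminf_lt (by isBoundedDefault) hcS
  refine le_limsup_of_frequently_le ?_ (by isBoundedDefault)
  rw [frequently_atTop]
  intro N₀
  have hlim : Tendsto (fun n : ℕ => (1 - x / x') * (n : ℝ)) atTop atTop :=
    tendsto_natCast_atTop_atTop.const_mul_atTop (sub_pos.2 ((div_lt_one hx'0).2 hxx))
  obtain ⟨n, ⟨hnc, hnN⟩, hnx, hn1⟩ := ((hfreq.and_eventually (eventually_ge_atTop N₀)).and_eventually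
    ((hlim.eventually_ge_atTop x).and (eventually_ge_atTop 1))).exists
  have hw := lt_coe_mul_of_div_lt hn1 hnc
  have hn0 : (0 : ℝ) < n := by exact_mod_cast hn1
  set N := ⌈(n : ℝ) / x'⌉₊ with hN
  have hNle : (n : ℝ) / x' ≤ N := Nat.le_ceil _
  have hNlt : (N : ℝ) < n / x' + 1 := Nat.ceil_lt_add_one (by positivity)
  have h1 : c * n + 2 * n = n / x' := by rw [hc]; field_simp; ring
  have hnN' : n ≤ N := by
    have : (n : ℝ) ≤ N := by nlinarith
    exact_mod_cast this
  refine ⟨N, hnN.trans hnN', coe_le_div_of_mul_le (hn1.trans hnN') (le_trans ?_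
    (natCast_le_wHatStarExp_of_add_le hζ hn1 (by positivity) hw (by linarith)))⟩
  have h2 : x * N ≤ x * (n / x' + 1) := by gcongr
  have h3 : x * (n / x' + 1) = x / x' * n + x := by ring
  have : x * N ≤ (n : ℝ) := by linarith
  exact_mod_cast this

theorem wHatStarExp_le_of_le_half {ζ : ℝ} (hζ : Transcendental ℚ ζ) {n N : ℕ} (hn : 1 ≤ n) {w : ℝ}
    (hw0 : 0 < w) (hNw : N ≤ w / 2) (hw : (w : EReal) < wExp n ζ) :
    wHatStarExp N ζ ≤ ((2 * n * (1 + 1 / w) : ℝ) : EReal) := by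
  refine (wHatStarExp_le hζ hn (by linarith) hw).trans ?_
  rw [EReal.coe_le_coe_iff]
  have hn0 : (0 : ℝ) ≤ n := Nat.cast_nonneg n
  calc n * (w + 1) / (w - N) ≤ n * (w + 1) / (w / 2) := by
        gcongr
        linarith
    _ = 2 * n * (1 + 1 / w) := by field_simp

/-- If `w_n(ζ) > c n` for some large `n`, the bound `ŵ*_N(ζ) ≤ 2n + 2/c` at `N ≈ c n / 2` gives
`ŵ*_N(ζ) / N ≲ 4 / c`. -/
theorem wHatStarInf_le_four_div {ζ : ℝ} (hζ : Transcendental ℚ ζ) :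
    wHatStarInf ζ ≤ 4 / wSup ζ := by
  have hS0 : 0 < wSup ζ := zero_lt_one.trans_le ((one_le_wInf hζ).trans (wInf_le_wSup ζ))
  refine EReal.le_of_forall_lt_iff_le.1 fun y hy => ?_
  have hy0 : 0 < y := by
    have : (0 : EReal) ≤ 4 / wSup ζ := EReal.div_nonneg (by norm_num) hS0.le
    exact_mod_cast this.trans_lt hy
  obtain ⟨c, hyc, hcS⟩ := EReal.lt_iff_exists_real_btwn.1
    (coe_div_lt_of_div_lt hS0 (k := 4) hy0 (by exact_mod_cast hy))
  have hyc' : 4 < c * y := by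
    have : 4 / y < c := by exact_mod_cast hyc
    rwa [div_lt_iff₀ hy0] at this
  have hc0 : 0 < c := by
    by_contra! h
    nlinarith
  have hfreq : ∃ᶠ n : ℕ in atTop, (c : EReal) < wExp n ζ / (n : EReal) :=
    frequently_lt_of_lt_limsup (by isBoundedDefault) hcS
  refine liminf_le_of_frequently_le ?_ (by isBoundedDefault)
  rw [frequently_atTop]
  intro N₀
  have hlim : Tendsto (fun n : ℕ => c / 2 * (n : ℝ)) atTop atTop :=
    tendsto_natCast_atTop_atTop.const_mul_atTop (by positivity)
  have hlim2 : Tendsto (fun n : ℕ => (c * y / 2 - 2) * (n : ℝ)) atTop atTop :=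
    tendsto_natCast_atTop_atTop.const_mul_atTop (by linarith)
  obtain ⟨n, hnc, ⟨hnN, hny⟩, hn1⟩ := (hfreq.and_eventually
    (((hlim.eventually_ge_atTop ((N₀ + 1 : ℕ) : ℝ)).and
      (hlim2.eventually_ge_atTop (y + 2 / c))).and (eventually_ge_atTop 1))).exists
  have hn0 : (0 : ℝ) < n := by exact_mod_cast hn1
  set N := ⌊c / 2 * (n : ℝ)⌋₊ with hN
  have hNN : N₀ + 1 ≤ N := Nat.le_floor hnN
  have hNle : (N : ℝ) ≤ c / 2 * n := Nat.floor_le (by positivity)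
  have hNlt : c / 2 * (n : ℝ) < N + 1 := Nat.lt_floor_add_one _
  refine ⟨N, by omega, div_le_coe_of_le_mul (by omega)
    ((wHatStarExp_le_of_le_half hζ hn1 (w := c * n) (by positivity) (by linarith)
      (coe_mul_lt_of_lt_div hn1 hnc)).trans ?_)⟩
  rw [EReal.coe_le_coe_iff]
  have h1 : 2 * n * (1 + 1 / (c * n)) = 2 * n + 2 / c := by field_simp
  rw [h1]
  nlinarith

theorem wHatStarSup_le_four_div {ζ : ℝ} (hζ : Transcendental ℚ ζ) :
    wHatStarSup ζ ≤ 4 / wInf ζ := by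
  have hS0 : 0 < wInf ζ := zero_lt_one.trans_le (one_le_wInf hζ)
  refine EReal.le_of_forall_lt_iff_le.1 fun y hy => ?_
  have hy0 : 0 < y := by
    have : (0 : EReal) ≤ 4 / wInf ζ := EReal.div_nonneg (by norm_num) hS0.le
    exact_mod_cast this.trans_lt hy
  obtain ⟨c, hyc, hcS⟩ := EReal.lt_iff_exists_real_btwn.1
    (coe_div_lt_of_div_lt hS0 (k := 4) hy0 (by exact_mod_cast hy))
  have hyc' : 4 / y < c := by exact_mod_cast hyc
  have hc0 : 0 < c := lt_trans (by positivity) hyc'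
  have hyc2 : 4 / c < y := by
    rw [div_lt_iff₀ hy0] at hyc'
    rw [div_lt_iff₀ hc0]
    linarith
  obtain ⟨n₀, hn₀⟩ := eventually_atTop.1 (eventually_lt_of_lt_liminf hcS)
  refine limsup_le_of_le (by isBoundedDefault) ?_
  have hlim : Tendsto (fun N : ℕ => 2 / c * (N : ℝ)) atTop atTop :=
    tendsto_natCast_atTop_atTop.const_mul_atTop (by positivity)
  have hlim2 : Tendsto (fun N : ℕ => (y - 4 / c) * (N : ℝ)) atTop atTop :=
    tendsto_natCast_atTop_atTop.const_mul_atTop (by linarith)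
  filter_upwards [hlim.eventually_ge_atTop ((n₀ + 1 : ℕ) : ℝ),
    hlim2.eventually_ge_atTop (2 + 2 / c), eventually_ge_atTop 1] with N hN1 hN2 hN
  set n := ⌈2 / c * (N : ℝ)⌉₊ with hn
  have hnle : 2 / c * (N : ℝ) ≤ n := Nat.le_ceil _
  have hnlt : (n : ℝ) < 2 / c * N + 1 := Nat.ceil_lt_add_one (by positivity)
  have hnn : n₀ + 1 ≤ n := by
    have := hN1.trans hnle
    exact_mod_cast this
  have hn1 : 1 ≤ n := by omega
  have hn0 : (0 : ℝ) < n := by exact_mod_cast hn1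
  refine div_le_coe_of_le_mul hN
    ((wHatStarExp_le_of_le_half hζ hn1 (w := c * n) (by positivity) ?_
      (coe_mul_lt_of_lt_div hn1 (hn₀ n (by omega)))).trans ?_)
  · have h1 : c * (2 / c * (N : ℝ)) ≤ c * n := by gcongr
    have h2 : c * (2 / c * (N : ℝ)) = 2 * N := by field_simp
    linarith
  · rw [EReal.coe_le_coe_iff]
    have h1 : 2 * n * (1 + 1 / (c * n)) = 2 * n + 2 / c := by field_simp
    have h2 : 2 * (2 / c * (N : ℝ)) = 4 / c * N := by ring
    rw [h1]
    linarith

/-! ### Comparison of the orders of growth -/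

theorem extLog_mono {u v : EReal} (h : u ≤ v) : extLog u ≤ extLog v :=
  ENNReal.log_monotone (EReal.toENNReal_le_toENNReal h)

theorem extLog_coe {x : ℝ} (hx : 0 < x) : extLog (x : EReal) = (Real.log x : EReal) := by
  rw [extLog, EReal.toENNReal_of_ne_top (EReal.coe_ne_top x), EReal.toReal_coe,
    ENNReal.log_ofReal_of_pos hx]

theorem extLog_rpow_div {N : ℕ} (hN : 2 ≤ N) (x : ℝ) :
    extLog (((N : ℝ) ^ x : ℝ) : EReal) / (Real.log N : EReal) = x := by
  have hN1 : (1 : ℝ) < N := by exact_mod_cast hN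
  have hlog : 0 < Real.log N := Real.log_pos hN1
  rw [extLog_coe (by positivity), Real.log_rpow (by linarith), ← EReal.coe_div,
    mul_div_cancel_right₀ _ hlog.ne']

theorem extLog_div_mono {N : ℕ} {u v : EReal} (h : u ≤ v) :
    extLog u / (Real.log N : EReal) ≤ extLog v / (Real.log N : EReal) :=
  EReal.div_le_div_right_of_nonneg (by exact_mod_cast Real.log_natCast_nonneg N) (extLog_mono h)

theorem le_extLog_div {N : ℕ} (hN : 2 ≤ N) {x : ℝ} {u : EReal}
    (h : (((N : ℝ) ^ x : ℝ) : EReal) ≤ u) : (x : EReal) ≤ extLog u / (Real.log N : EReal) :=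
  (extLog_rpow_div hN x).symm.trans_le (extLog_div_mono h)

theorem extLog_div_le {N : ℕ} (hN : 2 ≤ N) {x : ℝ} {u : EReal}
    (h : u ≤ (((N : ℝ) ^ x : ℝ) : EReal)) : extLog u / (Real.log N : EReal) ≤ x :=
  (extLog_div_mono h).trans_eq (extLog_rpow_div hN x)

theorem one_le_tauOrder {ζ : ℝ} (hζ : Transcendental ℚ ζ) : 1 ≤ tauOrder ζ := by
  refine le_limsup_of_frequently_le (Eventually.frequently ?_) (by isBoundedDefault)
  filter_upwards [eventually_ge_atTop 2] with n hn
  rw [← EReal.coe_one]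
  refine le_extLog_div hn ?_
  rw [Real.rpow_one]
  exact_mod_cast natCast_le_wExp hζ (by omega)

/-- If `x < 1 / τ(ζ)`, then every large `N` admits some `n ≥ N ^ x` for which the lower bound for
`ŵ*_N` and the upper bound for `λ_N` hold: `n ≈ (N / 3) ^ x'` with `x'` slightly above `x`. -/
theorem exists_of_lt_one_div_tauOrder {ζ : ℝ} (hζ : Transcendental ℚ ζ) {x : ℝ} (hx0 : 0 ≤ x)
    (hx : (x : EReal) < 1 / tauOrder ζ) :
    ∀ᶠ N : ℕ in atTop, ∃ (n : ℕ) (w : ℝ), 1 ≤ n ∧ 0 ≤ w ∧ wExp n ζ < w ∧ w + 2 * n ≤ N ∧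
      (N : ℝ) ^ x ≤ n := by
  have hτ := one_le_tauOrder hζ
  obtain ⟨x', hxx', hx'⟩ := EReal.lt_iff_exists_real_btwn.1 hx
  have hxx : x < x' := by exact_mod_cast hxx'
  have hx'0 : 0 < x' := hx0.trans_lt hxx
  set t := 1 / x' with ht
  have hτt : tauOrder ζ < t :=
    lt_div_of_coe_lt_div (zero_lt_one.trans_le hτ) hx'0 (by exact_mod_cast hx')
  have ht1 : 1 < t := by exact_mod_cast hτ.trans_lt hτt
  obtain ⟨n₀, hn₀⟩ := eventually_atTop.1 (eventually_lt_of_limsup_lt hτt)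
  have hlim : Tendsto (fun N : ℕ => ((N : ℝ) / 3) ^ x') atTop atTop :=
    (tendsto_rpow_atTop hx'0).comp (tendsto_natCast_atTop_atTop.atTop_div_const (by norm_num))
  filter_upwards [hlim.eventually_ge_atTop ((n₀ + 2 : ℕ) : ℝ),
    tendsto_natCast_atTop_atTop.eventually (eventually_mul_rpow_le hxx (2 * 3 ^ x')),
    eventually_ge_atTop 1] with N hN1 hN2 hN
  set n := ⌊((N : ℝ) / 3) ^ x'⌋₊ with hn
  have hN0 : (0 : ℝ) < N := by exact_mod_cast hN
  have hnn : n₀ + 2 ≤ n := Nat.le_floor hN1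
  have hn1 : (1 : ℝ) ≤ n := by exact_mod_cast (show 1 ≤ n by omega)
  have hnle : (n : ℝ) ≤ ((N : ℝ) / 3) ^ x' := Nat.floor_le (by positivity)
  have hnlt : ((N : ℝ) / 3) ^ x' < n + 1 := Nat.lt_floor_add_one _
  have hw : wExp n ζ < (((n : ℝ) ^ t : ℝ) : EReal) := by
    by_contra! h
    exact not_lt.2 (le_extLog_div (by omega) h) (hn₀ n (by omega))
  have hnt : (n : ℝ) ^ t ≤ N / 3 := by
    calc (n : ℝ) ^ t ≤ (((N : ℝ) / 3) ^ x') ^ t := by gcongr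
      _ = N / 3 := by
        rw [← Real.rpow_mul (by positivity), ht, mul_one_div_cancel hx'0.ne', Real.rpow_one]
  have hnt2 : (n : ℝ) ≤ (n : ℝ) ^ t := Real.self_le_rpow_of_one_le hn1 ht1.le
  refine ⟨n, (n : ℝ) ^ t, by omega, by positivity, hw, by linarith, ?_⟩
  rw [Real.div_rpow hN0.le (by norm_num)] at hnlt
  have h3 : (0 : ℝ) < 3 ^ x' := by positivity
  rw [div_lt_iff₀ h3] at hnlt
  have h4 : 2 * (3 : ℝ) ^ x' * (N : ℝ) ^ x ≤ 2 * 3 ^ x' * n := by nlinarith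
  exact le_of_mul_le_mul_left h4 (by positivity)

/-- If `y > 1 / τ(ζ)`, then there are arbitrarily large `N` and some `n ≪ N ^ y` for which the upper
bound for `ŵ*_N` and the lower bound for `λ_N` hold: `N` is about half of `n ^ t < w_n(ζ)`, with `t`
slightly below `τ(ζ)`. -/
theorem exists_of_one_div_tauOrder_lt {ζ : ℝ} (hζ : Transcendental ℚ ζ) {y : ℝ}
    (hy : 1 / tauOrder ζ < (y : EReal)) (N₀ : ℕ) :
    ∃ (n N : ℕ) (w : ℝ), 1 ≤ n ∧ N₀ ≤ N ∧ 1 ≤ w ∧ 2 * N ≤ w ∧ (w : EReal) < wExp n ζ ∧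
      4 * (n : ℝ) ≤ (N : ℝ) ^ y := by
  have hτ0 : 0 < tauOrder ζ := zero_lt_one.trans_le (one_le_tauOrder hζ)
  have hy0 : 0 < y := by
    have : (0 : EReal) ≤ 1 / tauOrder ζ := EReal.div_nonneg (by norm_num) hτ0.le
    exact_mod_cast this.trans_lt hy
  obtain ⟨t, hyt, htτ⟩ := EReal.lt_iff_exists_real_btwn.1
    (coe_div_lt_of_div_lt hτ0 (k := 1) hy0 (by exact_mod_cast hy))
  have hyt' : 1 / y < t := by exact_mod_cast hyt
  have ht0 : 0 < t := lt_trans (by positivity) hyt'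
  have hty : 1 < t * y := by rwa [div_lt_iff₀ hy0] at hyt'
  have hfreq : ∃ᶠ n : ℕ in atTop, (t : EReal) < extLog (wExp n ζ) / (Real.log n : EReal) :=
    frequently_lt_of_lt_limsup (by isBoundedDefault) htτ
  have hlim : Tendsto (fun n : ℕ => (n : ℝ) ^ t / 2) atTop atTop :=
    ((tendsto_rpow_atTop ht0).comp tendsto_natCast_atTop_atTop).atTop_div_const (by norm_num)
  obtain ⟨n, hnt, ⟨hnN, hny⟩, hn2⟩ := (hfreq.and_eventually
    (((hlim.eventually_ge_atTop ((N₀ + 2 : ℕ) : ℝ)).and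
      (tendsto_natCast_atTop_atTop.eventually (eventually_mul_rpow_le hty (4 * 4 ^ y)))).and
      (eventually_ge_atTop 2))).exists
  have hn0 : (0 : ℝ) < n := by exact_mod_cast (show 0 < n by omega)
  set N := ⌊(n : ℝ) ^ t / 2⌋₊ with hN
  have hNN : N₀ + 2 ≤ N := Nat.le_floor hnN
  have hN2 : (2 : ℝ) ≤ N := by exact_mod_cast (show 2 ≤ N by omega)
  have hNle : (N : ℝ) ≤ (n : ℝ) ^ t / 2 := Nat.floor_le (by positivity)
  have hNlt : (n : ℝ) ^ t / 2 < N + 1 := Nat.lt_floor_add_one _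
  have hw : (((n : ℝ) ^ t : ℝ) : EReal) < wExp n ζ := by
    by_contra! h
    exact not_lt.2 (extLog_div_le hn2 h) hnt
  refine ⟨n, N, (n : ℝ) ^ t, by omega, by omega, by linarith, by linarith, hw, ?_⟩
  have h1 : ((n : ℝ) ^ t / 4) ^ y ≤ (N : ℝ) ^ y := by
    gcongr
    linarith
  refine le_trans ?_ h1
  rw [Real.div_rpow (by positivity) (by norm_num), ← Real.rpow_mul hn0.le,
    le_div_iff₀ (by positivity)]
  rw [Real.rpow_one] at hny
  linarith

theorem thetaOrder_eq {ζ : ℝ} (hζ : Transcendental ℚ ζ) : thetaOrder ζ = 1 / tauOrder ζ := by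
  refine le_antisymm (EReal.le_of_forall_lt_iff_le.1 fun y hy => ?_)
    (EReal.ge_of_forall_gt_iff_ge.1 fun x hx => ?_)
  · refine liminf_le_of_frequently_le ?_ (by isBoundedDefault)
    rw [frequently_atTop]
    intro N₀
    obtain ⟨n, N, w, hn, hN, hw1, hNw, hw, hnN⟩ := exists_of_one_div_tauOrder_lt hζ hy (N₀ + 2)
    refine ⟨N, by omega, extLog_div_le (by omega)
      ((wHatStarExp_le_of_le_half hζ hn (by linarith) (by linarith) hw).trans ?_)⟩
    rw [EReal.coe_le_coe_iff]
    refine le_trans ?_ hnN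
    have : 1 / w ≤ 1 := by rw [div_le_one (by linarith)]; exact hw1
    have hn0 : (0 : ℝ) ≤ n := Nat.cast_nonneg n
    nlinarith
  · refine le_liminf_of_le (by isBoundedDefault) ?_
    rcases lt_or_ge x 0 with hx0 | hx0
    · filter_upwards [eventually_ge_atTop 2] with N hN
      refine le_extLog_div hN (le_trans ?_ (one_le_wHatStarExp ζ (by omega)))
      have : (N : ℝ) ^ x ≤ 1 := Real.rpow_le_one_of_one_le_of_nonpos
        (by exact_mod_cast (show 1 ≤ N by omega)) hx0.le
      exact_mod_cast this
    · filter_upwards [exists_of_lt_one_div_tauOrder hζ hx0 hx, eventually_ge_atTop 2] with N hN hN2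
      obtain ⟨n, w, hn, hw0, hw, hwN, hNx⟩ := hN
      refine le_extLog_div hN2 (le_trans ?_
        (natCast_le_wHatStarExp_of_add_le hζ hn hw0 hw hwN))
      exact_mod_cast hNx

theorem one_div_tauOrder_eq {ζ : ℝ} (hζ : Transcendental ℚ ζ) (hL : ¬ Liouville ζ) :
    1 / tauOrder ζ = -sigmaOrder ζ := by
  refine le_antisymm (EReal.ge_of_forall_gt_iff_ge.1 fun x hx => ?_)
    (EReal.le_of_forall_lt_iff_le.1 fun y hy => ?_)
  · rw [EReal.le_neg, ← EReal.coe_neg]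
    refine limsup_le_of_le (by isBoundedDefault) ?_
    rcases lt_or_ge x 0 with hx0 | hx0
    · obtain ⟨C, hC0, hC⟩ := exists_lamExp_le_of_not_liouville hζ hL
      filter_upwards [tendsto_natCast_atTop_atTop.eventually
        (eventually_mul_rpow_le (show (0 : ℝ) < -x by linarith) C), eventually_ge_atTop 2] with N h1 hN
      refine extLog_div_le hN ((hC N (by omega)).trans ?_)
      rw [Real.rpow_zero, mul_one] at h1
      exact_mod_cast h1
    · filter_upwards [exists_of_lt_one_div_tauOrder hζ hx0 hx, eventually_ge_atTop 2] with N hN hN2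
      obtain ⟨n, w, hn, hw0, hw, hwN, hNx⟩ := hN
      refine extLog_div_le hN2 ((lamExp_le_of_add_le hζ hn hw0 hw hwN).trans ?_)
      rw [EReal.coe_le_coe_iff, Real.rpow_neg (Nat.cast_nonneg N), one_div]
      have hN0 : (0 : ℝ) < N := by exact_mod_cast (show 0 < N by omega)
      gcongr
  · rw [EReal.neg_le, ← EReal.coe_neg]
    refine le_limsup_of_frequently_le ?_ (by isBoundedDefault)
    rw [frequently_atTop]
    intro N₀
    obtain ⟨n, N, w, hn, hN, hw1, hNw, hw, hnN⟩ := exists_of_one_div_tauOrder_lt hζ hy (N₀ + 4)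
    refine ⟨N, by omega, le_extLog_div (by omega) (le_trans ?_
      (one_div_le_lamExp hn (by omega) (lt_of_le_of_lt (by exact_mod_cast hNw) hw)))⟩
    have hn0 : (0 : ℝ) < n := by exact_mod_cast hn
    rw [EReal.coe_le_coe_iff, Real.rpow_neg (Nat.cast_nonneg N), one_div]
    gcongr
    linarith

theorem theorem2p6 (ζ : ℝ) (hζ : Transcendental ℚ ζ) :
    (1 / (wSup ζ + 2) ≤ wHatStarInf ζ ∧ wHatStarInf ζ ≤ min (wInf ζ) (4 / wSup ζ)) ∧
    (1 / (wInf ζ + 2) ≤ wHatStarSup ζ ∧ wHatStarSup ζ ≤ min (wSup ζ) (4 / wInf ζ)) ∧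
    thetaOrder ζ = 1 / tauOrder ζ ∧
    (¬ Liouville ζ → 1 / tauOrder ζ = -sigmaOrder ζ) :=
  ⟨⟨one_div_wSup_add_two_le hζ, le_min (liminf_le_liminf (wHatStarExp_div_le_wExp_div hζ))
      (wHatStarInf_le_four_div hζ)⟩,
    ⟨one_div_wInf_add_two_le hζ, le_min (limsup_le_limsup (wHatStarExp_div_le_wExp_div hζ))
      (wHatStarSup_le_four_div hζ)⟩,
    thetaOrder_eq hζ, one_div_tauOrder_eq hζ⟩
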